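/- All graphs are finite, undirected and simple. A **Hoffman graph** $\mathfrak h$ is a graph whose vertices are labelled *slim* or *fat* such that every fat vertex has a slim neighbour and no two fat vertices are adjacent; $V(\mathfrak h)$, $V_s(\mathfrak h)$, $V_f(\mathfrak h)$ are its sets of all, slim, and fat vertices, and $N^f_{\mathfrak h}(x)$ is the set of fat neighbours of $x$. Isomorphisms preserve labels, and membership of a Hoffman graph in a family is understood up to isomorphism. It is called *slim* if it has no fat vertices, and *fat* if every slim vertex has a fat neighbour. A *Hoffman subgraph* of $\mathfrak h$ is an induced subgraph, with the restricted labels, that is itself a Hoffman graph. A Hoffman graph $\mathfrak h$ is the **sum** $\bigoplus_i\mathfrak h^i$ of finitely many of its Hoffman subgraphs $\mathfrak h^i$ if $V(\mathfrak h)=\bigcup_i V(\mathfrak h^i)$; $V_s(\mathfrak h)$ is the disjoint union of the $V_s(\mathfrak h^i)$; $N^f_{\mathfrak h^i}(x)=N^f_{\mathfrak h}(x)$ for all $i$ and $x\in V_s(\mathfrak h^i)$; and for $i\ne j$, $x\in V_s(\mathfrak h^i)$, $y\in V_s(\mathfrak h^j)$ one has $|N^f_{\mathfrak h}(x)\cap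 N^f_{\mathfrak h}(y)|\le 1$, with equality if and only if $x$ and $y$ are adjacent. $\mathfrak h$ is *indecomposable* if it is not the sum of two non-empty Hoffman subgraphs. Let $\mathfrak h_2$ be the Hoffman graph consisting of one slim vertex adjacent to two fat vertices. Let $\mathfrak O$ be the family consisting of $\mathfrak h_2$ and of all indecomposable fat Hoffman graphs $\mathfrak h$ with $|V_s(\mathfrak h)|\ge 2$ and $|V_f(\mathfrak h)|=1$. For a family $\mathfrak H\subset\mathfrak O$ put $$\bar{\mathfrak H}=\{\mathfrak h_2\}\cup\{\mathfrak h\in\mathfrak O : \mathfrak h\text{ is a Hoffman subgraph of an element of }\mathfrak H\}.$$ For a family $\mathfrak F$ of Hoffman graphs, an **$\mathfrak F$-cover** of a Hoffman graph $\mathfrak g$ is a Hoffman graph $\mathfrak h=\bigoplus_{i=0}^n\mathfrak h^i$ with all $\mathfrak h^i\in\mathfrak F$ that contains $\mathfrak g$ as a Hoffman subgraph; it is **strict** if $V_s(\mathfrak h)=V_s(\mathfrak g)$. Two strict $\mathfrak F$-covers of $\mathfrak g$ are **equivalent** if there is an isomorphism between them that is the identity on $V(\mathfrak g)$. A **slim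 $\mathfrak F$-line graph** is a slim Hoffman graph (that is, an ordinary graph) that has an $\mathfrak F$-cover. **Theorem 1.4.** Let $\mathfrak H\subset\mathfrak O$ be a family of Hoffman graphs with $\mathfrak h_2\in\mathfrak H$, and let $N\ge 7$ be an integer. Suppose that every connected slim $\mathfrak H$-line graph of order $N$ has exactly one strict $\bar{\mathfrak H}$-cover up to equivalence. Then every connected slim $\mathfrak H$-line graph of order at least $N$ has exactly one strict $\bar{\mathfrak H}$-cover up to equivalence. -/

import Mathlib

universe u v w

/-- A (finite) Hoffman graph: a finite simple graph with a labelling of its vertices as "fat" or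
"slim" (a vertex is slim if it is not fat), such that every fat vertex has a slim neighbour and
no two fat vertices are adjacent. -/
structure HoffmanGraph : Type (u + 1) where
  /-- the vertices -/
  V : Type u
  finite : Finite V
  /-- the underlying graph -/
  graph : SimpleGraph V
  /-- the labelling -/
  IsFat : V → Prop
  exists_slim_adj : ∀ x, IsFat x → ∃ y, ¬ IsFat y ∧ graph.Adj x y
  fat_not_adj : ∀ x y, IsFat x → IsFat y → ¬ graph.Adj x y

namespace HoffmanGraph

attribute [instance] HoffmanGraph.finite

/-- The set of slim vertices. -/
def slimVerts (h : HoffmanGraph.{u}) : Set h.V := {x | ¬ h.IsFat x}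

/-- The set of fat vertices. -/
def fatVerts (h : HoffmanGraph.{u}) : Set h.V := {x | h.IsFat x}

/-- The set of fat neighbours of a vertex. -/
def fatNbrs (h : HoffmanGraph.{u}) (x : h.V) : Set h.V := {y | h.IsFat y ∧ h.graph.Adj x y}

/-- A Hoffman graph without fat vertices, i.e. an ordinary graph. -/
def IsSlim (h : HoffmanGraph.{u}) : Prop := ∀ x, ¬ h.IsFat x

/-- The property called "fat" for Hoffman graphs: every slim vertex has a fat neighbour. -/
def AllSlimHaveFatNbr (h : HoffmanGraph.{u}) : Prop :=
  ∀ x, ¬ h.IsFat x → ∃ y, h.IsFat y ∧ h.graph.Adj x y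

/-- Label-preserving graph isomorphisms. -/
structure Iso (g : HoffmanGraph.{u}) (h : HoffmanGraph.{v}) where
  toIso : g.graph ≃g h.graph
  isFat_iff : ∀ x, h.IsFat (toIso x) ↔ g.IsFat x

/-- Label-preserving embeddings of `g` as an induced subgraph of `h`: these realise `g` as a
Hoffman subgraph of `h`. -/
structure Embedding (g : HoffmanGraph.{u}) (h : HoffmanGraph.{v}) where
  toEmbedding : g.graph ↪g h.graph
  isFat_iff : ∀ x, h.IsFat (toEmbedding x) ↔ g.IsFat x

/-- An (induced) Hoffman subgraph of `h`, given by its vertex set. It has to be a Hoffman graph,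
so each of its fat vertices must have a slim neighbour in it. -/
structure Subgraph (h : HoffmanGraph.{u}) where
  verts : Set h.V
  exists_slim_adj : ∀ x ∈ verts, h.IsFat x → ∃ y ∈ verts, ¬ h.IsFat y ∧ h.graph.Adj x y

/-- A Hoffman subgraph, as a Hoffman graph in its own right. -/
def Subgraph.toHoffmanGraph {h : HoffmanGraph.{u}} (k : h.Subgraph) : HoffmanGraph.{u} where
  V := k.verts
  finite := inferInstance
  graph := h.graph.induce k.verts
  IsFat := fun x => h.IsFat x.1
  exists_slim_adj := by
    rintro ⟨x, hx⟩ hf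
    obtain ⟨y, hy, hs, ha⟩ := k.exists_slim_adj x hx hf
    exact ⟨⟨y, hy⟩, hs, ha⟩
  fat_not_adj := fun x y hx hy => h.fat_not_adj x.1 y.1 hx hy

/-- `h` is the sum `⨁ i, k i` of its Hoffman subgraphs `k i`. -/
structure IsSum (h : HoffmanGraph.{u}) {ι : Type w} (k : ι → h.Subgraph) : Prop where
  /-- The subgraphs cover all the vertices. -/
  verts_eq : (⋃ i, (k i).verts) = Set.univ
  /-- The sets of slim vertices of the subgraphs are pairwise disjoint. -/
  slim_disjoint : ∀ i j, i ≠ j →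
    Disjoint ((k i).verts ∩ h.slimVerts) ((k j).verts ∩ h.slimVerts)
  /-- A slim vertex of `k i` has the same fat neighbours in `k i` as in `h`. -/
  fatNbrs_eq : ∀ i, ∀ x ∈ (k i).verts, ¬ h.IsFat x →
    h.fatNbrs x ∩ (k i).verts = h.fatNbrs x
  /-- Slim vertices of different summands have at most one common fat neighbour ... -/
  common_le_one : ∀ i j, i ≠ j → ∀ x ∈ (k i).verts, ∀ y ∈ (k j).verts,
    ¬ h.IsFat x → ¬ h.IsFat y → (h.fatNbrs x ∩ h.fatNbrs y).ncard ≤ 1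
  /-- ... and they have one exactly if they are adjacent. -/
  common_eq_one_iff : ∀ i j, i ≠ j → ∀ x ∈ (k i).verts, ∀ y ∈ (k j).verts,
    ¬ h.IsFat x → ¬ h.IsFat y →
      ((h.fatNbrs x ∩ h.fatNbrs y).ncard = 1 ↔ h.graph.Adj x y)

/-- `h` is not the sum of two non-empty Hoffman subgraphs. -/
def Indecomposable (h : HoffmanGraph.{u}) : Prop :=
  ¬ ∃ k₁ k₂ : h.Subgraph, k₁.verts.Nonempty ∧ k₂.verts.Nonempty ∧ h.IsSum ![k₁, k₂]

/-- The Hoffman graph `𝔥₂`: one slim vertex (the vertex `0`) adjacent to two fat vertices. -/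
def h2 : HoffmanGraph.{0} where
  V := Fin 3
  finite := inferInstance
  graph :=
    { Adj := fun x y => x ≠ y ∧ (x = 0 ∨ y = 0)
      symm := ⟨fun _ _ hxy => ⟨hxy.1.symm, hxy.2.symm⟩⟩
      loopless := ⟨fun _ hx => hx.1 rfl⟩ }
  IsFat := fun x => x ≠ 0
  exists_slim_adj := fun _ hx => ⟨0, fun h => h rfl, hx, Or.inr rfl⟩
  fat_not_adj := fun _ _ hx hy hxy => hxy.2.elim hx hy

/-- Membership in a family of Hoffman graphs, up to isomorphism. -/
def MemUpToIso (h : HoffmanGraph.{v}) (H : Set HoffmanGraph.{u}) : Prop :=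
  ∃ g ∈ H, Nonempty (Iso h g)

/-- The family `𝔒`: `𝔥₂` and the indecomposable fat Hoffman graphs with at least two slim vertices
and exactly one fat vertex. -/
def familyO : Set HoffmanGraph.{u} :=
  {h | Nonempty (Iso h h2) ∨
    (h.Indecomposable ∧ h.AllSlimHaveFatNbr ∧ 2 ≤ h.slimVerts.ncard ∧ h.fatVerts.ncard = 1)}

/-- The family obtained from `H` by taking `𝔥₂` and all members of `𝔒` that are (isomorphic to)
Hoffman subgraphs of members of `H`. -/
def familyBar (H : Set HoffmanGraph.{u}) : Set HoffmanGraph.{u} :=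
  {h | Nonempty (Iso h h2) ∨
    (h ∈ familyO ∧ ∃ g ∈ H, ∃ k : g.Subgraph, Nonempty (Iso h k.toHoffmanGraph))}

/-- An `H`-cover of `g`: a Hoffman graph `h` that is a sum of finitely many members of `H`,
together with a realisation of `g` as a Hoffman subgraph of `h`. -/
structure Cover (H : Set HoffmanGraph.{u}) (g : HoffmanGraph.{u}) where
  h : HoffmanGraph.{u}
  emb : Embedding g h
  exists_sum : ∃ (n : ℕ) (k : Fin (n + 1) → h.Subgraph),
    h.IsSum k ∧ ∀ i, (k i).toHoffmanGraph.MemUpToIso H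

/-- A cover of `g` is strict if it has the same slim vertices as `g`. -/
def Cover.IsStrict {H : Set HoffmanGraph.{u}} {g : HoffmanGraph.{u}} (c : Cover H g) : Prop :=
  c.emb.toEmbedding '' g.slimVerts = c.h.slimVerts

/-- Two covers of `g` are equivalent if there is an isomorphism between them that restricts to the
identity on `g`. -/
def Cover.Equivalent {H : Set HoffmanGraph.{u}} {g : HoffmanGraph.{u}} (c c' : Cover H g) : Prop :=
  ∃ φ : Iso c.h c'.h, ∀ x, φ.toIso (c.emb.toEmbedding x) = c'.emb.toEmbedding x

/-- `g` is an `H`-line Hoffman graph. -/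
def IsLine (H : Set HoffmanGraph.{u}) (g : HoffmanGraph.{u}) : Prop := Nonempty (Cover H g)

/-- Connected slim `H`-line graphs. -/
def IsConnectedSlimLine (H : Set HoffmanGraph.{u}) (g : HoffmanGraph.{u}) : Prop :=
  g.IsSlim ∧ IsLine H g ∧ g.graph.Connected

/-- `g` has exactly one strict `H`-cover up to equivalence. -/
def HasUniqueStrictCover (H : Set HoffmanGraph.{u}) (g : HoffmanGraph.{u}) : Prop :=
  (∃ c : Cover H g, c.IsStrict) ∧
    ∀ c c' : Cover H g, c.IsStrict → c'.IsStrict → c.Equivalent c'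

end HoffmanGraph

/-! The fat vertices of a cover of a slim graph G act as blocks on V(G), a point being incident with
its fat neighbours. The resulting relation is a root relation (`IsRoot`): each vertex lies in one or
two blocks, two vertices have at most one common block, adjacent vertices share a block, and a
vertex sharing a block with a non-neighbour lies in no other block. Non-adjacent pairs sharing a
block form the `defect` graph. For a strict cover, the summands are recovered as the connected
components of this graph: an isolated vertex gives `h2`, any other component gives a summand with
one fat vertex. So strict covers amount to strict root relations (`IsStrictRoot`) whose components
fit into members of H (`FitsBlocks`).

By induction it suffices to pass from order n to order n + 1, which rests on two facts.

The pairs sharing a block determine a strict root relation of a connected graph on at least seven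
vertices (`IsStrictRoot.exists_equiv`). This resembles Whitney's theorem on line graphs: if vertices
are read as edges and blocks as vertices of a root graph, the only obstruction is the exchange of a
claw and a triangle, and it is confined to six vertices.

Any two strict covers have the same shared pairs (`Cover.share_of_isStrict`). If x and y have
distance less than n, they lie in a connected induced subgraph of order n. Both covers restrict to
it and can be made strict there without changing shared pairs (`Cover.exists_isStrict`), so
uniqueness in order n applies. At distance n, the first vertices of a shortest path from x to y
serve as intermediaries. -/

namespace HoffmanGraph

/-! ### Linear incidence relations and their reconstruction from shared pairs -/

section Incidence

variable {V : Type u} {Φ : Type v} {Ψ : Type w}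

/-- Two points share a block of an incidence relation. -/
def Share (inc : V → Φ → Prop) (x y : V) : Prop := ∃ f, inc x f ∧ inc y f

theorem Share.symm {inc : V → Φ → Prop} {x y : V} (h : Share inc x y) : Share inc y x :=
  let ⟨f, hx, hy⟩ := h; ⟨f, hy, hx⟩

/-- Incidence relations in which every point lies in one or two blocks and two points lie in at
most one common block. -/
structure IsLinear (inc : V → Φ → Prop) : Prop where
  exists_inc : ∀ x, ∃ f, inc x f
  eq_of_three : ∀ x f g k, inc x f → inc x g → inc x k → f = g ∨ f = k ∨ g = k
  eq_of_common : ∀ x y f g, x ≠ y → inc x f → inc y f → inc x g → inc y g → f = g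

/-- A block that is not contained in a block of a relation with the same shared pairs is a
triangle whose three edges lie in different blocks of the other relation. -/
theorem IsLinear.subset_or_triangle {inc : V → Φ → Prop} {inc' : V → Ψ → Prop}
    (hl' : IsLinear inc') (he : ∀ x y, x ≠ y → Share inc x y → Share inc' x y)
    (f : Φ) (hf : ∃ x, inc x f) :
    (∃ f', ∀ x, inc x f → inc' x f') ∨
    ∃ a b c f₁ f₂ f₃, a ≠ b ∧ a ≠ c ∧ b ≠ c ∧ f₁ ≠ f₂ ∧ f₁ ≠ f₃ ∧ f₂ ≠ f₃ ∧
      (∀ x, inc x f ↔ x = a ∨ x = b ∨ x = c) ∧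
      inc' a f₁ ∧ inc' b f₁ ∧ inc' a f₂ ∧ inc' c f₂ ∧ inc' b f₃ ∧ inc' c f₃ := by
  by_contra! hcon
  obtain ⟨hsub, htri⟩ := hcon
  obtain ⟨a, ha⟩ := hf
  obtain ⟨f₀, hf₀⟩ := hl'.exists_inc a
  obtain ⟨b, hb, hb0⟩ := hsub f₀
  have hab : a ≠ b := by rintro rfl; exact hb0 hf₀
  obtain ⟨f₁, ha1, hb1⟩ := he a b hab ⟨f, ha, hb⟩
  obtain ⟨c, hc, hc1⟩ := hsub f₁
  have hac : a ≠ c := by rintro rfl; exact hc1 ha1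
  have hbc : b ≠ c := by rintro rfl; exact hc1 hb1
  obtain ⟨f₂, ha2, hc2⟩ := he a c hac ⟨f, ha, hc⟩
  obtain ⟨f₃, hb3, hc3⟩ := he b c hbc ⟨f, hb, hc⟩
  have h12 : f₁ ≠ f₂ := by rintro rfl; exact hc1 hc2
  have h13 : f₁ ≠ f₃ := by rintro rfl; exact hc1 hc3
  have h23 : f₂ ≠ f₃ := by
    rintro rfl
    exact h12 (hl'.eq_of_common a b _ _ hab ha1 hb1 ha2 hb3)
  refine htri a b c f₁ f₂ f₃ hab hac hbc h12 h13 h23 (fun d => ⟨fun hd => ?_, ?_⟩)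
    ha1 hb1 ha2 hc2 hb3 hc3
  -- A fourth point d of the block would share an `inc'`-block with each corner. Each corner has
  -- only two of `f₁`, `f₂`, `f₃` as its blocks and no `fᵢ` contains all three corners, so d lies in
  -- two of them. These two already meet in a corner, against linearity.
  · by_contra! hne
    obtain ⟨hda, hdb, hdc⟩ := hne
    obtain ⟨g₁, hd1, hg1⟩ := he d a hda ⟨f, hd, ha⟩
    obtain ⟨g₂, hd2, hg2⟩ := he d b hdb ⟨f, hd, hb⟩
    obtain ⟨g₃, hd3, hg3⟩ := he d c hdc ⟨f, hd, hc⟩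
    have e1 := hl'.eq_of_three a f₁ f₂ g₁ ha1 ha2 hg1
    have e2 := hl'.eq_of_three b f₁ f₃ g₂ hb1 hb3 hg2
    have e3 := hl'.eq_of_three c f₂ f₃ g₃ hc2 hc3 hg3
    have n1 : ¬ (inc' d f₁ ∧ inc' d f₂) := fun h =>
      h12 (hl'.eq_of_common d a _ _ hda h.1 ha1 h.2 ha2)
    have n2 : ¬ (inc' d f₁ ∧ inc' d f₃) := fun h =>
      h13 (hl'.eq_of_common d b _ _ hdb h.1 hb1 h.2 hb3)
    have n3 : ¬ (inc' d f₂ ∧ inc' d f₃) := fun h =>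
      h23 (hl'.eq_of_common d c _ _ hdc h.1 hc2 h.2 hc3)
    rcases e1 with e1 | e1 | e1 <;> rcases e2 with e2 | e2 | e2 <;>
      rcases e3 with e3 | e3 | e3 <;> subst_vars <;> tauto
  · rintro (rfl | rfl | rfl) <;> assumption

/-- A triangle block meeting three blocks of a relation with the same shared pairs: each of these
three blocks has at most one further point, and the points sharing a block with it lie in blocks
through a corner. -/
theorem IsLinear.block_of_triangle {inc : V → Φ → Prop} {inc' : V → Ψ → Prop}
    (hl : IsLinear inc) (he : ∀ x y, x ≠ y → (Share inc x y ↔ Share inc' x y))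
    {f : Φ} {a b c : V} {f₁ : Ψ} (hab : a ≠ b)
    (hf : ∀ x, inc x f ↔ x = a ∨ x = b ∨ x = c) (ha : inc' a f₁) (hb : inc' b f₁)
    (hc : ¬ inc' c f₁) :
    ∃ z, (∀ x, inc' x f₁ → x = a ∨ x = b ∨ x = z) ∧
      ∀ y, Share inc z y → Share inc a y ∨ Share inc b y := by
  have hfa : inc a f := (hf a).2 (by simp)
  have hfb : inc b f := (hf b).2 (by simp)
  rcases hl.subset_or_triangle (fun x y hxy => (he x y hxy).2) f₁ ⟨a, ha⟩ with
    ⟨g, hg⟩ | ⟨p, q, r, g₁, g₂, g₃, hpq, hpr, hqr, h12, h13, h23, hpqr, hp1, hq1, hp2, hr2, hq3,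
      hr3⟩
  -- If `f₁` is contained in an `inc`-block, that block is f, so `f₁` has no points besides a and b;
  -- the witness z = a is a dummy.
  · obtain rfl := hl.eq_of_common a b _ _ hab hfa hfb (hg a ha) (hg b hb)
    refine ⟨a, fun x hx => ?_, fun y h => Or.inl h⟩
    rcases (hf x).1 (hg x hx) with h | h | rfl
    · simp [h]
    · simp [h]
    · exact absurd hx hc
  -- Otherwise `f₁` is itself a triangle, with z its third corner: the only two `inc`-blocks of z
  -- pass through the other two corners, one each.
  · have key : ∀ z u v : V, ∀ k₁ k₂, k₁ ≠ k₂ → inc z k₁ → inc z k₂ → inc u k₁ → inc v k₂ →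
        ∀ y, Share inc z y → Share inc u y ∨ Share inc v y := by
      rintro z u v k₁ k₂ hk hz1 hz2 hu hv y ⟨k, hzk, hyk⟩
      rcases hl.eq_of_three z k₁ k₂ k hz1 hz2 hzk with h | rfl | rfl
      · exact absurd h hk
      · exact Or.inl ⟨_, hu, hyk⟩
      · exact Or.inr ⟨_, hv, hyk⟩
    have kp := key p q r g₁ g₂ h12 hp1 hp2 hq1 hr2
    have kq := key q p r g₁ g₃ h13 hq1 hq3 hp1 hr3
    have kr := key r p q g₂ g₃ h23 hr2 hr3 hp2 hq3
    rcases (hpqr a).1 ha with rfl | rfl | rfl <;> rcases (hpqr b).1 hb with rfl | rfl | rfl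
    · exact absurd rfl hab
    · exact ⟨r, fun x hx => (hpqr x).1 hx, kr⟩
    · exact ⟨q, fun x hx => by have := (hpqr x).1 hx; tauto, kq⟩
    · exact ⟨r, fun x hx => by have := (hpqr x).1 hx; tauto, fun y hy => (kr y hy).symm⟩
    · exact absurd rfl hab
    · exact ⟨p, fun x hx => by have := (hpqr x).1 hx; tauto, kp⟩
    · exact ⟨q, fun x hx => by have := (hpqr x).1 hx; tauto, fun y hy => (kq y hy).symm⟩
    · exact ⟨p, fun x hx => by have := (hpqr x).1 hx; tauto, fun y hy => (kp y hy).symm⟩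
    · exact absurd rfl hab

/-- In a connected situation with at least seven points, linear relations with the same shared
pairs have no exceptional triangles. -/
theorem IsLinear.exists_subset [Finite V] {inc : V → Φ → Prop} {inc' : V → Ψ → Prop}
    (hl : IsLinear inc) (hl' : IsLinear inc')
    (he : ∀ x y, x ≠ y → (Share inc x y ↔ Share inc' x y))
    {G : SimpleGraph V} (hG : G.Connected) (hadj : ∀ x y, G.Adj x y → Share inc x y)
    (hcard : 7 ≤ Nat.card V) (f : Φ) (hf : ∃ x, inc x f) :
    ∃ f', ∀ x, inc x f → inc' x f' := by
  classical
  rcases hl'.subset_or_triangle (fun x y hxy => (he x y hxy).1) f hf with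
    h | ⟨a, b, c, f₁, f₂, f₃, hab, hac, hbc, h12, h13, h23, habc, ha1, hb1, ha2, hc2, hb3, hc3⟩
  · exact h
  exfalso
  have hc1 : ¬ inc' c f₁ := fun h => h12 (hl'.eq_of_common a c _ _ hac ha1 h ha2 hc2)
  have hb2 : ¬ inc' b f₂ := fun h => h12 (hl'.eq_of_common a b _ _ hab ha1 hb1 ha2 h)
  have ha3 : ¬ inc' a f₃ := fun h => h13 (hl'.eq_of_common a b _ _ hab ha1 hb1 h hb3)
  obtain ⟨z₁, hz1, hn1⟩ := hl.block_of_triangle he hab habc ha1 hb1 hc1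
  obtain ⟨z₂, hz2, hn2⟩ := hl.block_of_triangle (c := b) he hac
    (fun x => by rw [habc]; tauto) ha2 hc2 hb2
  obtain ⟨z₃, hz3, hn3⟩ := hl.block_of_triangle (c := a) he hbc
    (fun x => by rw [habc]; tauto) hb3 hc3 ha3
  let S : V → Prop := fun x => inc' x f₁ ∨ inc' x f₂ ∨ inc' x f₃
  have corner : ∀ t, t = a ∨ t = b ∨ t = c → ∀ y, Share inc t y → S y := by
    intro t ht y hty
    by_cases hne : t = y
    · subst hne
      rcases ht with rfl | rfl | rfl
      · exact Or.inl ha1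
      · exact Or.inl hb1
      · exact Or.inr (Or.inl hc2)
    · obtain ⟨k, htk, hyk⟩ := (he t y hne).1 hty
      rcases ht with rfl | rfl | rfl
      · rcases hl'.eq_of_three _ f₁ f₂ k ha1 ha2 htk with h | rfl | rfl
        exacts [absurd h h12, Or.inl hyk, Or.inr (Or.inl hyk)]
      · rcases hl'.eq_of_three _ f₁ f₃ k hb1 hb3 htk with h | rfl | rfl
        exacts [absurd h h13, Or.inl hyk, Or.inr (Or.inr hyk)]
      · rcases hl'.eq_of_three _ f₂ f₃ k hc2 hc3 htk with h | rfl | rfl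
        exacts [absurd h h23, Or.inr (Or.inl hyk), Or.inr (Or.inr hyk)]
  have ca := corner a (by simp)
  have cb := corner b (by simp)
  have cc := corner c (by simp)
  -- The union S of the three blocks is closed under sharing: anything reached from some `zᵢ` is
  -- also reached from a corner, and the blocks of the corners are among `f₁`, `f₂`, `f₃`. By
  -- connectedness S is everything.
  have closed : ∀ x y, S x → Share inc x y → S y := by
    intro x y hx hxy
    rcases hx with hx | hx | hx
    · rcases hz1 x hx with rfl | rfl | rfl
      exacts [ca y hxy, cb y hxy, (hn1 y hxy).elim (ca y) (cb y)]
    · rcases hz2 x hx with rfl | rfl | rfl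
      exacts [ca y hxy, cc y hxy, (hn2 y hxy).elim (ca y) (cc y)]
    · rcases hz3 x hx with rfl | rfl | rfl
      exacts [cb y hxy, cc y hxy, (hn3 y hxy).elim (cb y) (cc y)]
  have all : ∀ y, S y := by
    intro y
    obtain ⟨p⟩ := hG.preconnected a y
    have : ∀ {s t : V} (_ : G.Walk s t), S s → S t := by
      intro s t p
      induction p with
      | nil => exact id
      | cons h _ ih => exact fun hs => ih (closed _ _ hs (hadj _ _ h))
    exact this p (Or.inl ha1)
  -- Three corners and at most three further points: this is where seven vertices are needed. The
  -- extreme case corresponds to the six edges of K₄.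
  have huniv : (Set.univ : Set V) ⊆ (({a, b, c, z₁, z₂, z₃} : Finset V) : Set V) := by
    intro x _
    simp only [Finset.coe_insert, Finset.coe_singleton, Set.mem_insert_iff,
      Set.mem_singleton_iff]
    rcases all x with h | h | h
    · have := hz1 x h; tauto
    · have := hz2 x h; tauto
    · have := hz3 x h; tauto
  have h6 := (Set.ncard_le_ncard huniv (Finset.finite_toSet _)).trans
    ((Set.ncard_coe_finset _).trans_le Finset.card_le_six)
  rw [Set.ncard_univ] at h6
  omega

/-- The pairs of non-adjacent points that share a block. -/
def defect (G : SimpleGraph V) (inc : V → Φ → Prop) : SimpleGraph V where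
  Adj x y := x ≠ y ∧ ¬ G.Adj x y ∧ Share inc x y
  symm := ⟨fun _ _ h => ⟨h.1.symm, fun h' => h.2.1 h'.symm, h.2.2.symm⟩⟩
  loopless := ⟨fun _ h => h.1 rfl⟩

/-- Incidence relations that describe the fat vertices of a sum of copies of `𝔥₂` and of Hoffman
graphs with one fat vertex, without the condition on the members of the sum. -/
structure IsRoot (G : SimpleGraph V) (inc : V → Φ → Prop) : Prop extends IsLinear inc where
  share_of_adj : ∀ x y, G.Adj x y → Share inc x y
  eq_of_defect : ∀ x y f g, (defect G inc).Adj x y → inc x f → inc x g → f = g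

/-- Root relations in which every block has a point, and every point lying in only one block has a
non-neighbour in it. -/
structure IsStrictRoot (G : SimpleGraph V) (inc : V → Φ → Prop) : Prop
    extends IsRoot G inc where
  exists_point : ∀ f, ∃ x, inc x f
  exists_defect : ∀ x f, (∀ g, inc x g → g = f) → ∃ y, (defect G inc).Adj x y

theorem defect_eq_of_share {G : SimpleGraph V} {inc : V → Φ → Prop} {inc' : V → Ψ → Prop}
    (he : ∀ x y, x ≠ y → (Share inc x y ↔ Share inc' x y)) : defect G inc = defect G inc' := by
  ext x y
  simp only [defect]
  constructor
  · rintro ⟨h1, h2, h3⟩; exact ⟨h1, h2, (he x y h1).1 h3⟩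
  · rintro ⟨h1, h2, h3⟩; exact ⟨h1, h2, (he x y h1).2 h3⟩

/-- A block with two points is contained in a block of the other relation, which is contained in a
block of the first; linearity makes these equal. A one-point block {x} is recovered indirectly, as
the block of x other than the one shared with a neighbour. -/
theorem IsStrictRoot.exists_block_eq [Finite V] {inc : V → Φ → Prop} {inc' : V → Ψ → Prop}
    {G : SimpleGraph V} (hl : IsStrictRoot G inc) (hl' : IsStrictRoot G inc')
    (he : ∀ x y, x ≠ y → (Share inc x y ↔ Share inc' x y)) (hG : G.Connected)
    (hcard : 7 ≤ Nat.card V) (f : Φ) : ∃ f', ∀ x, inc x f ↔ inc' x f' := by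
  have sub := hl.toIsLinear.exists_subset hl'.toIsLinear he hG hl.share_of_adj hcard
  have sub' := hl'.toIsLinear.exists_subset hl.toIsLinear (fun x y h => (he x y h).symm) hG
    hl'.share_of_adj hcard
  have big : ∀ f x y, x ≠ y → inc x f → inc y f → ∃ f', ∀ x, inc x f ↔ inc' x f' := by
    intro f x y hxy hx hy
    obtain ⟨f', hf'⟩ := sub f ⟨x, hx⟩
    obtain ⟨g, hg⟩ := sub' f' ⟨x, hf' x hx⟩
    obtain rfl := hl.eq_of_common x y _ _ hxy hx hy (hg _ (hf' _ hx)) (hg _ (hf' _ hy))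
    exact ⟨f', fun z => ⟨hf' z, hg z⟩⟩
  obtain ⟨x, hx⟩ := hl.exists_point f
  by_cases hs : ∃ y, x ≠ y ∧ inc y f
  · obtain ⟨y, hxy, hy⟩ := hs
    exact big f x y hxy hx hy
  push Not at hs
  have : Nontrivial V := (Finite.one_lt_card_iff_nontrivial).1 (by omega)
  obtain ⟨y, hxy⟩ := hG.preconnected.exists_adj_of_nontrivial x
  obtain ⟨g, hxg, hyg⟩ := hl.share_of_adj x y hxy
  have hfg : f ≠ g := by rintro rfl; exact hs y hxy.ne hyg
  obtain ⟨g', hg'⟩ := big g x y hxy.ne hxg hyg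
  -- If `g'` were the only block of x, strictness would give x a defect. Defects depend only on
  -- shared pairs, so x would have a single block in `inc` too, contradicting f ≠ g.
  have : ∃ f', f' ≠ g' ∧ inc' x f' := by
    by_contra! hcon
    obtain ⟨z, hz⟩ := hl'.exists_defect x g' fun k hk => by
      by_contra hne; exact hcon k hne hk
    rw [← defect_eq_of_share he] at hz
    exact hfg (hl.eq_of_defect x z f g hz hx hxg)
  obtain ⟨f', hne, hxf'⟩ := this
  refine ⟨f', fun z => ?_⟩
  by_cases hxz : x = z
  · subst hxz; exact ⟨fun _ => hxf', fun _ => hx⟩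
  refine ⟨fun h => absurd h (hs z hxz), fun h => ?_⟩
  obtain ⟨k, hxk, hzk⟩ := (he x z hxz).2 ⟨f', hxf', h⟩
  rcases hl.eq_of_three x f g k hx hxg hxk with h' | rfl | rfl
  · exact absurd h' hfg
  · exact absurd hzk (hs z hxz)
  · exact absurd (hl'.eq_of_common x z _ _ hxz hxf' h ((hg' x).1 hxk) ((hg' z).1 hzk)) hne

/-- A point x in two equal blocks has no third one, so a neighbour of x lies in both, against
linearity. -/
theorem IsStrictRoot.block_injective [Nontrivial V] {inc : V → Φ → Prop} {G : SimpleGraph V}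
    (hl : IsStrictRoot G inc) (hG : G.Connected) {f g : Φ} (h : ∀ x, inc x f ↔ inc x g) :
    f = g := by
  by_contra hfg
  obtain ⟨x, hx⟩ := hl.exists_point f
  obtain ⟨y, hxy⟩ := hG.preconnected.exists_adj_of_nontrivial x
  obtain ⟨k, hxk, hyk⟩ := hl.share_of_adj x y hxy
  have : inc y f := by
    rcases hl.eq_of_three x f g k hx ((h x).1 hx) hxk with h' | rfl | rfl
    exacts [absurd h' hfg, hyk, (h y).2 hyk]
  exact hfg (hl.eq_of_common x y f g hxy.ne hx this ((h x).1 hx) ((h y).1 this))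

/-- A strict root relation of a connected graph with at least seven vertices is determined by its
shared pairs. -/
theorem IsStrictRoot.exists_equiv [Finite V] {inc : V → Φ → Prop} {inc' : V → Ψ → Prop}
    {G : SimpleGraph V} (hl : IsStrictRoot G inc) (hl' : IsStrictRoot G inc')
    (he : ∀ x y, x ≠ y → (Share inc x y ↔ Share inc' x y)) (hG : G.Connected)
    (hcard : 7 ≤ Nat.card V) : ∃ σ : Φ ≃ Ψ, ∀ x f, inc x f ↔ inc' x (σ f) := by
  have : Nontrivial V := (Finite.one_lt_card_iff_nontrivial).1 (by omega)
  choose σ hσ using hl.exists_block_eq hl' he hG hcard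
  have hσ' := hl'.exists_block_eq hl (fun x y h => (he x y h).symm) hG hcard
  refine ⟨Equiv.ofBijective σ ⟨fun f g hfg => ?_, fun f' => ?_⟩, fun x f => hσ f x⟩
  · exact hl.block_injective hG fun x => by rw [hσ f, hσ g, hfg]
  · obtain ⟨f, hf⟩ := hσ' f'
    exact ⟨f, hl'.block_injective hG fun x => by rw [hf, hσ]⟩

end Incidence

/-! ### Connected induced subgraphs through two given vertices -/

/-- In a connected graph, two vertices whose distance is not the maximal conceivable one lie in a
connected induced subgraph with one vertex less. -/
theorem exists_connected_induce {V : Type u} [Finite V] {G : SimpleGraph V} (hG : G.Connected)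
    {n : ℕ} (hn : Nat.card V = n + 1) {x y : V} (hxy : G.dist x y < n) :
    ∃ A : Set V, x ∈ A ∧ y ∈ A ∧ Nat.card A = n ∧ (G.induce A).Connected := by
  classical
  -- Starting from the vertex set of a shortest path, which has `dist + 1` elements, vertices are
  -- added one at a time up to any prescribed size.
  have grow : ∀ k, G.dist x y + 1 ≤ k → k ≤ n + 1 →
      ∃ A : Set V, x ∈ A ∧ y ∈ A ∧ G.dist x y + 1 ≤ A.ncard ∧ A.ncard = k ∧
        (G.induce A).Connected := by
    intro k hk
    induction k, hk using Nat.le_induction with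
    | base =>
      intro _
      obtain ⟨p, hp, hlen⟩ := hG.exists_path_of_dist x y
      have hc : {v | v ∈ p.support}.ncard = G.dist x y + 1 := by
        have : {v | v ∈ p.support} = (p.support.toFinset : Set V) := by ext; simp
        rw [this, Set.ncard_coe_finset, List.toFinset_card_of_nodup hp.support_nodup,
          p.length_support, hlen]
      exact ⟨{v | v ∈ p.support}, p.start_mem_support, p.end_mem_support, hc.ge, hc,
        p.connected_induce_support⟩
    | succ k hk ih =>
      intro hkn
      obtain ⟨A, hx, hy, hd, hA, hAc⟩ := ih (by omega)
      have : ∃ w, w ∉ A := by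
        by_contra! h
        have : A = Set.univ := Set.eq_univ_of_forall h
        rw [this, Set.ncard_univ] at hA
        omega
      obtain ⟨w, hw⟩ := this
      -- A walk from x to a vertex outside A has an edge leaving A; its outer end can be added
      -- without losing connectedness.
      obtain ⟨p⟩ := hG.preconnected x w
      obtain ⟨d, -, hd1, hd2⟩ := p.exists_boundary_dart A hx hw
      refine ⟨insert d.snd A, Or.inr hx, Or.inr hy, ?_, ?_, ?_⟩
      · rw [Set.ncard_insert_of_notMem hd2]; omega
      · rw [Set.ncard_insert_of_notMem hd2]; omega
      · have := SimpleGraph.connected_induce_union (G := G) (s := A) (t := {d.snd})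
          hAc.preconnected (by simp) hd1 rfl d.adj
        rwa [Set.union_singleton] at this
  obtain ⟨A, hx, hy, -, hA, hAc⟩ := grow n (by omega) (by omega)
  exact ⟨A, hx, hy, by rwa [Nat.card_coe_set_eq], hAc⟩

end HoffmanGraph

namespace HoffmanGraph

/-! ### The possible summands -/

section Families

/-- The identity isomorphism. -/
def Iso.refl (g : HoffmanGraph.{u}) : Iso g g := ⟨SimpleGraph.Iso.refl, fun _ => Iff.rfl⟩

/-- The inverse isomorphism. -/
def Iso.symm {g : HoffmanGraph.{u}} {h : HoffmanGraph.{v}} (e : Iso g h) : Iso h g :=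
  ⟨e.toIso.symm, fun x => by rw [← e.isFat_iff, RelIso.apply_symm_apply]⟩

/-- An isomorphism as an embedding. -/
def Iso.emb {g : HoffmanGraph.{u}} {h : HoffmanGraph.{v}} (e : Iso g h) : Embedding g h :=
  ⟨e.toIso.toEmbedding, e.isFat_iff⟩

/-- The composition of embeddings. -/
def Embedding.trans {g : HoffmanGraph.{u}} {h : HoffmanGraph.{v}} {k : HoffmanGraph.{w}}
    (e : Embedding g h) (e' : Embedding h k) : Embedding g k :=
  ⟨e'.toEmbedding.comp e.toEmbedding, fun x => (e'.isFat_iff _).trans (e.isFat_iff x)⟩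

/-- The inclusion of a Hoffman subgraph. -/
def Subgraph.incl {h : HoffmanGraph.{u}} (k : h.Subgraph) : Embedding k.toHoffmanGraph h :=
  ⟨SimpleGraph.Embedding.induce _, fun _ => Iff.rfl⟩

/-- The image of an embedding. -/
def Embedding.range {g : HoffmanGraph.{u}} {h : HoffmanGraph.{v}} (e : Embedding g h) :
    h.Subgraph where
  verts := Set.range e.toEmbedding
  exists_slim_adj := by
    rintro _ ⟨x, rfl⟩ hx
    obtain ⟨y, hy, hxy⟩ := g.exists_slim_adj x ((e.isFat_iff x).1 hx)
    exact ⟨_, ⟨y, rfl⟩, fun h => hy ((e.isFat_iff y).1 h), e.toEmbedding.map_adj_iff.2 hxy⟩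

theorem Embedding.nonempty_iso_range {g : HoffmanGraph.{u}} {h : HoffmanGraph.{v}}
    (e : Embedding g h) : Nonempty (Iso g e.range.toHoffmanGraph) :=
  ⟨⟨⟨Equiv.ofInjective _ e.toEmbedding.injective, fun {_ _} => e.toEmbedding.map_adj_iff⟩,
    e.isFat_iff⟩⟩

/-- One slim vertex adjacent to two fat vertices. -/
def IsDouble (h : HoffmanGraph.{u}) : Prop :=
  ∃ x f g, f ≠ g ∧ ¬ h.IsFat x ∧ h.IsFat f ∧ h.IsFat g ∧ h.graph.Adj x f ∧ h.graph.Adj x g ∧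
    ∀ y, y = x ∨ y = f ∨ y = g

/-- One fat vertex, adjacent to all slim vertices. -/
def IsPointed (h : HoffmanGraph.{u}) : Prop :=
  ∃ f, h.IsFat f ∧ (∀ g, h.IsFat g → g = f) ∧ ∀ x, ¬ h.IsFat x → h.graph.Adj x f

theorem IsDouble.of_iso {g : HoffmanGraph.{u}} {h : HoffmanGraph.{v}} (e : Iso g h)
    (hd : h.IsDouble) : g.IsDouble := by
  obtain ⟨x, f, k, hfk, hx, hf, hk, hxf, hxk, hall⟩ := hd
  refine ⟨e.symm.toIso x, e.symm.toIso f, e.symm.toIso k, e.symm.toIso.injective.ne hfk,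
    fun h' => hx ((e.symm.isFat_iff x).1 h'), (e.symm.isFat_iff f).2 hf,
    (e.symm.isFat_iff k).2 hk, e.symm.toIso.map_adj_iff.2 hxf, e.symm.toIso.map_adj_iff.2 hxk,
    fun y => ?_⟩
  have hy : e.symm.toIso (e.toIso y) = y := e.toIso.symm_apply_apply y
  rcases hall (e.toIso y) with h' | h' | h' <;> rw [← hy, h'] <;> simp

theorem IsPointed.of_iso {g : HoffmanGraph.{u}} {h : HoffmanGraph.{v}} (e : Iso g h)
    (hd : h.IsPointed) : g.IsPointed := by
  obtain ⟨f, hf, huniq, hadj⟩ := hd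
  refine ⟨e.symm.toIso f, (e.symm.isFat_iff f).2 hf, fun k hk => ?_, fun x hx => ?_⟩
  · rw [← huniq _ ((e.isFat_iff k).2 hk)]
    exact (e.toIso.symm_apply_apply k).symm
  · rw [← e.toIso.map_adj_iff]
    have : e.toIso (e.symm.toIso f) = f := e.toIso.apply_symm_apply f
    rw [this]
    exact hadj _ fun h' => hx ((e.isFat_iff x).1 h')

theorem isDouble_h2 : h2.IsDouble := by
  refine ⟨(0 : Fin 3), (1 : Fin 3), (2 : Fin 3), (by decide : (1 : Fin 3) ≠ 2),
    fun h => h rfl,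
    (by decide : (1 : Fin 3) ≠ 0), (by decide : (2 : Fin 3) ≠ 0),
    ⟨(by decide : (0 : Fin 3) ≠ 1), Or.inl rfl⟩, ⟨(by decide : (0 : Fin 3) ≠ 2), Or.inl rfl⟩, ?_⟩
  exact (by decide : ∀ y : Fin 3, y = 0 ∨ y = 1 ∨ y = 2)

theorem IsDouble.isFat_iff {h : HoffmanGraph.{u}} {x f g : h.V} (hx : ¬ h.IsFat x)
    (hf : h.IsFat f) (hg : h.IsFat g) (hall : ∀ y, y = x ∨ y = f ∨ y = g) (y : h.V) :
    h.IsFat y ↔ y ≠ x := by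
  refine ⟨fun h h' => hx (h' ▸ h), fun h => ?_⟩
  rcases hall y with rfl | rfl | rfl
  exacts [absurd rfl h, hf, hg]

theorem IsDouble.adj_iff {h : HoffmanGraph.{u}} {x f g : h.V} (hx : ¬ h.IsFat x) (hf : h.IsFat f)
    (hg : h.IsFat g) (hxf : h.graph.Adj x f) (hxg : h.graph.Adj x g)
    (hall : ∀ y, y = x ∨ y = f ∨ y = g) (y z : h.V) :
    h.graph.Adj y z ↔ y ≠ z ∧ (y = x ∨ z = x) := by
  constructor
  · refine fun hyz => ⟨hyz.ne, ?_⟩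
    by_contra! hcon
    have hfat := IsDouble.isFat_iff hx hf hg hall
    exact h.fat_not_adj y z ((hfat y).2 hcon.1) ((hfat z).2 hcon.2) hyz
  · have hadj : ∀ y, y ≠ x → h.graph.Adj x y := fun y hy => by
      rcases hall y with rfl | rfl | rfl
      exacts [absurd rfl hy, hxf, hxg]
    rintro ⟨hne, rfl | rfl⟩
    · exact hadj z hne.symm
    · exact (hadj y hne).symm

theorem IsDouble.nonempty_iso {g : HoffmanGraph.{u}} {h : HoffmanGraph.{v}} (hg : g.IsDouble)
    (hh : h.IsDouble) : Nonempty (Iso g h) := by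
  classical
  obtain ⟨x, f, k, hfk, hx, hf, hk, hxf, hxk, hall⟩ := hg
  obtain ⟨x', f', k', hfk', hx', hf', hk', hxf', hxk', hall'⟩ := hh
  have n1 : f ≠ x := by rintro rfl; exact hx hf
  have n2 : k ≠ x := by rintro rfl; exact hx hk
  have n1' : f' ≠ x' := by rintro rfl; exact hx' hf'
  have n2' : k' ≠ x' := by rintro rfl; exact hx' hk'
  let φ : g.V → h.V := fun y => if y = x then x' else if y = f then f' else k'
  let ψ : h.V → g.V := fun y => if y = x' then x else if y = f' then f else k
  have φx : φ x = x' := by simp [φ]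
  have φf : φ f = f' := by simp [φ, n1]
  have φk : φ k = k' := by simp [φ, n2, hfk.symm]
  have ψx : ψ x' = x := by simp [ψ]
  have ψf : ψ f' = f := by simp [ψ, n1']
  have ψk : ψ k' = k := by simp [ψ, n2', hfk'.symm]
  let e : g.V ≃ h.V :=
    { toFun := φ
      invFun := ψ
      left_inv := fun y => by rcases hall y with h | h | h <;> simp [*]
      right_inv := fun y => by rcases hall' y with h | h | h <;> simp [*] }
  have ex : ∀ y, e y = x' ↔ y = x := fun y => by
    rw [← e.apply_eq_iff_eq (x := y) (y := x)]
    have : e x = x' := φx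
    rw [this]
  refine ⟨⟨⟨e, fun {a b} => ?_⟩, fun a => ?_⟩⟩
  · rw [IsDouble.adj_iff hx hf hk hxf hxk hall,
      IsDouble.adj_iff hx' hf' hk' hxf' hxk' hall', ex, ex, e.injective.ne_iff]
  · change h.IsFat (e a) ↔ g.IsFat a
    rw [IsDouble.isFat_iff hx hf hk hall, IsDouble.isFat_iff hx' hf' hk' hall', Ne, ex]

/-- If x were adjacent to all other slim vertices, the graph would be the sum of {x, f} and the
graph with x removed: any two slim vertices have exactly the fat vertex f in common. -/
theorem IsPointed.exists_nonadj {h : HoffmanGraph.{u}} (hp : h.IsPointed) (hi : h.Indecomposable)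
    (h2 : 2 ≤ h.slimVerts.ncard) (x : h.V) (hx : ¬ h.IsFat x) :
    ∃ y, ¬ h.IsFat y ∧ x ≠ y ∧ ¬ h.graph.Adj x y := by
  obtain ⟨f, hf, huniq, hadj⟩ := hp
  by_contra! hcon
  obtain ⟨y, hy, hyx⟩ := Set.exists_ne_of_one_lt_ncard (show 1 < h.slimVerts.ncard by omega) x
  have hyx : x ≠ y := hyx.symm
  have hy : ¬ h.IsFat y := hy
  have hxf : x ≠ f := by rintro rfl; exact hx hf
  have hnb : ∀ z, ¬ h.IsFat z → h.fatNbrs z = {f} := by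
    intro z hz
    ext g
    constructor
    · exact fun hg => huniq g hg.1
    · rintro rfl; exact ⟨hf, hadj z hz⟩
  have cross : ∀ z w, ¬ h.IsFat z → ¬ h.IsFat w → (h.fatNbrs z ∩ h.fatNbrs w).ncard = 1 := by
    intro z w hz hw
    rw [hnb z hz, hnb w hw]; simp
  refine hi ⟨⟨{x, f}, ?_⟩, ⟨{z | z ≠ x}, ?_⟩, ⟨x, by simp⟩, ⟨y, hyx.symm⟩, ?_⟩
  · rintro z (rfl | rfl) hz
    · exact absurd hz hx
    · exact ⟨x, by simp, hx, (hadj x hx).symm⟩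
  · intro z _ hz
    obtain rfl := huniq z hz
    exact ⟨y, hyx.symm, hy, (hadj y hy).symm⟩
  · refine ⟨?_, ?_, ?_, ?_, ?_⟩
    · refine Set.eq_univ_of_forall fun z => Set.mem_iUnion.2 ?_
      by_cases hz : z = x
      · exact ⟨0, by simp [hz]⟩
      · exact ⟨1, by simpa using hz⟩
    · intro i j hij
      rw [Set.disjoint_left]
      rintro z ⟨hz1, hz⟩ ⟨hz2, -⟩
      have hzf : z ≠ f := by rintro rfl; exact hz hf
      fin_cases i <;> fin_cases j <;> simp_all
    · intro i z hz hzs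
      rw [Set.inter_eq_left, hnb z hzs]
      rintro _ rfl
      fin_cases i
      · simp
      · simpa using hxf.symm
    · intro i j _ z _ w _ hz hw
      exact (cross z w hz hw).le
    · intro i j hij z hz w hw hzs hws
      refine ⟨fun _ => ?_, fun _ => cross z w hzs hws⟩
      have hzf : z ≠ f := by rintro rfl; exact hzs hf
      have hwf : w ≠ f := by rintro rfl; exact hws hf
      fin_cases i <;> fin_cases j <;> simp_all
      · exact hcon w hws (Ne.symm hw)
      · exact (hcon z hzs (Ne.symm hz)).symm

/-- All slim vertices share the fat vertex, so slim vertices in different summands must be adjacent.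
A splitting would therefore disconnect the non-adjacency relation on slim vertices. -/
theorem indecomposable_of_reachable {h : HoffmanGraph.{u}} (hp : h.IsPointed)
    {D : SimpleGraph h.V}
    (hD : ∀ x y, D.Adj x y → ¬ h.IsFat x ∧ ¬ h.IsFat y ∧ ¬ h.graph.Adj x y)
    (hr : ∀ x y, ¬ h.IsFat x → ¬ h.IsFat y → D.Reachable x y) : h.Indecomposable := by
  rintro ⟨k₁, k₂, ⟨x, hx⟩, ⟨y, hy⟩, hs⟩
  obtain ⟨f, hf, huniq, hadj⟩ := hp
  have slim : ∀ (k : h.Subgraph) (x), x ∈ k.verts → ∃ y ∈ k.verts, ¬ h.IsFat y := by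
    intro k x hx
    by_cases hxf : h.IsFat x
    · obtain ⟨y, hy, hy', -⟩ := k.exists_slim_adj x hx hxf
      exact ⟨y, hy, hy'⟩
    · exact ⟨x, hx, hxf⟩
  obtain ⟨x, hx, hxs⟩ := slim _ _ hx
  obtain ⟨y, hy, hys⟩ := slim _ _ hy
  have hy1 : y ∉ k₁.verts := fun hy1 =>
    Set.disjoint_left.1 (hs.slim_disjoint 0 1 (by decide)) ⟨hy1, hys⟩ ⟨hy, hys⟩
  obtain ⟨p⟩ := hr x y hxs hys
  obtain ⟨d, -, hd1, hd2⟩ := p.exists_boundary_dart k₁.verts hx hy1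
  obtain ⟨h1, h2, h3⟩ := hD _ _ d.adj
  have hd2' : d.snd ∈ k₂.verts := by
    obtain ⟨i, hi⟩ := Set.mem_iUnion.1 (hs.verts_eq.symm ▸ Set.mem_univ d.snd)
    fin_cases i
    · exact absurd hi hd2
    · exact hi
  refine h3 ((hs.common_eq_one_iff 0 1 (by decide) _ hd1 _ hd2' h1 h2).1 ?_)
  have hnb : ∀ z, ¬ h.IsFat z → h.fatNbrs z = {f} := by
    intro z hz
    ext g
    constructor
    · exact fun hg => huniq g hg.1
    · rintro rfl; exact ⟨hf, hadj z hz⟩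
  rw [hnb _ h1, hnb _ h2]; simp

/-- The properties of a summand that matter: it is `𝔥₂`, or it has one fat vertex, embeds into a
member of `H` with one fat vertex, and no slim vertex is adjacent to all the others. -/
def IsBlock (H : Set HoffmanGraph.{u}) (k : HoffmanGraph.{v}) : Prop :=
  k.IsDouble ∨ (k.IsPointed ∧ (∃ g ∈ H, g.IsPointed ∧ Nonempty (Embedding k g)) ∧
    ∀ x, ¬ k.IsFat x → ∃ y, ¬ k.IsFat y ∧ x ≠ y ∧ ¬ k.graph.Adj x y)

theorem IsBlock.of_iso {H : Set HoffmanGraph.{u}} {k : HoffmanGraph.{v}} {k' : HoffmanGraph.{w}}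
    (e : Iso k k') (hb : IsBlock H k') : IsBlock H k := by
  rcases hb with hb | ⟨hp, ⟨g, hg, hgp, ⟨i⟩⟩, hn⟩
  · exact Or.inl (hb.of_iso e)
  · refine Or.inr ⟨hp.of_iso e, ⟨g, hg, hgp, ⟨e.emb.trans i⟩⟩, fun x hx => ?_⟩
    obtain ⟨y, hy, hxy, ha⟩ := hn (e.toIso x) fun h => hx ((e.isFat_iff x).1 h)
    have hey : e.toIso (e.symm.toIso y) = y := e.toIso.apply_symm_apply y
    refine ⟨e.symm.toIso y, fun h => hy ((e.symm.isFat_iff y).1 h), ?_, ?_⟩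
    · rintro rfl; exact hxy hey
    · rw [← e.toIso.map_adj_iff, hey]; exact ha

theorem isPointed_of_ncard {h : HoffmanGraph.{u}} (h1 : h.AllSlimHaveFatNbr)
    (h2 : h.fatVerts.ncard = 1) : h.IsPointed := by
  obtain ⟨f, hf⟩ := Set.ncard_eq_one.1 h2
  have hfat : ∀ g, h.IsFat g ↔ g = f := fun g => by
    rw [← Set.mem_singleton_iff, ← hf]; rfl
  refine ⟨f, (hfat f).2 rfl, fun g hg => (hfat g).1 hg, fun x hx => ?_⟩
  obtain ⟨y, hy, hxy⟩ := h1 x hx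
  rwa [(hfat y).1 hy] at hxy

theorem isBlock_of_mem {H : Set HoffmanGraph.{u}} (hH : H ⊆ familyO) {k : HoffmanGraph.{u}}
    (hk : k ∈ H) : IsBlock H k := by
  rcases hH hk with ⟨⟨e⟩⟩ | ⟨hi, hf, h2, h1⟩
  · exact Or.inl (isDouble_h2.of_iso e)
  · have hp := isPointed_of_ncard hf h1
    exact Or.inr ⟨hp, ⟨k, hk, hp, ⟨(Iso.refl k).emb⟩⟩, hp.exists_nonadj hi h2⟩

theorem isBlock_of_mem_familyBar {H : Set HoffmanGraph.{u}} (hH : H ⊆ familyO)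
    {k : HoffmanGraph.{u}} (hk : k ∈ familyBar H) : IsBlock H k := by
  rcases hk with ⟨⟨e⟩⟩ | ⟨⟨⟨e'⟩⟩ | ⟨hi, hf, h2, h1⟩, g, hg, s, ⟨e⟩⟩
  · exact Or.inl (isDouble_h2.of_iso e)
  · exact Or.inl (isDouble_h2.of_iso e')
  · have hp := isPointed_of_ncard hf h1
    have i : Embedding k g := e.emb.trans s.incl
    refine Or.inr ⟨hp, ⟨g, hg, ?_, ⟨i⟩⟩, hp.exists_nonadj hi h2⟩
    -- The host g cannot be 𝔥₂: k has two slim vertices, and 𝔥₂ has room for one.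
    rcases isBlock_of_mem hH hg with ⟨x, f, f', -, hx, hf, hf', -, -, hall⟩ | hgp
    · exfalso
      obtain ⟨a, ha, b, hb, hab⟩ := (Set.one_lt_ncard (Set.toFinite _)).1
        (show 1 < k.slimVerts.ncard by omega)
      have key : ∀ a, ¬ k.IsFat a → i.toEmbedding a = x := by
        intro a ha
        have := fun h => ha ((i.isFat_iff a).1 h)
        rcases hall (i.toEmbedding a) with h | h | h
        · exact h
        · exact absurd (h ▸ hf) this
        · exact absurd (h ▸ hf') this
      exact hab (i.toEmbedding.injective ((key a ha).trans (key b hb).symm))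
    · exact hgp.1

end Families

end HoffmanGraph

namespace HoffmanGraph

/-! ### From sums to root relations -/

section FromCover

/-- `K` embeds into the slim part of a member of `H` with one fat vertex. -/
def Fits (H : Set HoffmanGraph.{u}) {W : Type v} (K : SimpleGraph W) : Prop :=
  ∃ g ∈ H, g.IsPointed ∧ ∃ φ : K ↪g g.graph, ∀ x, ¬ g.IsFat (φ x)

/-- The parts of the graph that belong to one summand embed into members of `H`. -/
def FitsBlocks (H : Set HoffmanGraph.{u}) {V : Type v} {Φ : Type w} (G : SimpleGraph V)
    (inc : V → Φ → Prop) : Prop :=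
  ∀ T : Set V, T.Nontrivial → (∀ x ∈ T, ∀ y ∈ T, (defect G inc).Reachable x y) →
    Fits H (G.induce T)

/-- The incidence relation with the fat vertices of a Hoffman graph containing `G`. -/
def fatInc {V : Type v} {G : SimpleGraph V} {h : HoffmanGraph.{u}} (φ : G ↪g h.graph) (x : V)
    (f : {f // h.IsFat f}) : Prop := h.graph.Adj (φ x) f

variable {V : Type v} {G : SimpleGraph V} {h : HoffmanGraph.{u}} {ι : Type w}
  {k : ι → h.Subgraph} {H : Set HoffmanGraph.{u}}

theorem IsSum.mem_of_adj (hs : h.IsSum k) {i : ι} {x f : h.V} (hx : x ∈ (k i).verts)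
    (hxs : ¬ h.IsFat x) (hf : h.IsFat f) (hxf : h.graph.Adj x f) : f ∈ (k i).verts :=
  Set.inter_eq_left.1 (hs.fatNbrs_eq i x hx hxs) ⟨hf, hxf⟩

theorem IsSum.eq_of_common (hs : h.IsSum k) {i j : ι} (hij : i ≠ j) {x y f g : h.V}
    (hx : x ∈ (k i).verts) (hy : y ∈ (k j).verts) (hxs : ¬ h.IsFat x) (hys : ¬ h.IsFat y)
    (hf : h.IsFat f) (hg : h.IsFat g) (hxf : h.graph.Adj x f) (hyf : h.graph.Adj y f)
    (hxg : h.graph.Adj x g) (hyg : h.graph.Adj y g) : f = g :=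
  (Set.ncard_le_one (Set.toFinite _)).1 (hs.common_le_one i j hij x hx y hy hxs hys) f
    ⟨⟨hf, hxf⟩, hf, hyf⟩ g ⟨⟨hg, hxg⟩, hg, hyg⟩

theorem IsSum.adj_of_common (hs : h.IsSum k) {i j : ι} (hij : i ≠ j) {x y f : h.V}
    (hx : x ∈ (k i).verts) (hy : y ∈ (k j).verts) (hxs : ¬ h.IsFat x) (hys : ¬ h.IsFat y)
    (hf : h.IsFat f) (hxf : h.graph.Adj x f) (hyf : h.graph.Adj y f) : h.graph.Adj x y := by
  refine (hs.common_eq_one_iff i j hij x hx y hy hxs hys).1 (le_antisymm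
    (hs.common_le_one i j hij x hx y hy hxs hys) ?_)
  exact (Set.ncard_pos (Set.toFinite _)).2 ⟨f, ⟨hf, hxf⟩, hf, hyf⟩

/-- The fat neighbours of a slim vertex of a block. -/
theorem IsSum.two_or_one (hs : h.IsSum k) (hb : ∀ i, IsBlock H (k i).toHoffmanGraph) {i : ι}
    {x : h.V} (hx : x ∈ (k i).verts) (hxs : ¬ h.IsFat x) :
    (∃ f g, f ≠ g ∧ h.IsFat f ∧ h.IsFat g ∧ h.graph.Adj x f ∧ h.graph.Adj x g ∧
      (∀ e, h.IsFat e → h.graph.Adj x e → e = f ∨ e = g) ∧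
      ∀ y ∈ (k i).verts, ¬ h.IsFat y → y = x) ∨
    (∃ f, h.IsFat f ∧ (∀ y ∈ (k i).verts, ¬ h.IsFat y → h.graph.Adj y f ∧
        ∀ e, h.IsFat e → h.graph.Adj y e → e = f) ∧
      (∃ g ∈ H, g.IsPointed ∧ Nonempty (Embedding (k i).toHoffmanGraph g)) ∧
      ∃ y ∈ (k i).verts, ¬ h.IsFat y ∧ x ≠ y ∧ ¬ h.graph.Adj x y) := by
  rcases hb i with ⟨⟨x', hx'⟩, ⟨f, hf⟩, ⟨g, hg⟩, hfg, hxs', hff, hgf, hxf, hxg, hall⟩ |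
    ⟨⟨⟨f, hf⟩, hff, huniq, hadj⟩, he, hn⟩
  · left
    have key : ∀ y ∈ (k i).verts, ¬ h.IsFat y → y = x' := by
      intro y hy hys
      rcases hall ⟨y, hy⟩ with h' | h' | h'
      · exact congrArg Subtype.val h'
      · obtain rfl : y = f := congrArg Subtype.val h'
        exact absurd hff hys
      · obtain rfl : y = g := congrArg Subtype.val h'
        exact absurd hgf hys
    obtain rfl := key x hx hxs
    refine ⟨f, g, fun h' => hfg (Subtype.ext h'), hff, hgf, hxf, hxg, fun e he hxe => ?_, key⟩
    rcases hall ⟨e, hs.mem_of_adj hx hxs he hxe⟩ with h' | h' | h'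
    · exact absurd (congrArg Subtype.val h') hxe.ne'
    · exact Or.inl (congrArg Subtype.val h')
    · exact Or.inr (congrArg Subtype.val h')
  · right
    refine ⟨f, hff, fun y hy hys => ⟨hadj ⟨y, hy⟩ hys, fun e he hye => ?_⟩, he, ?_⟩
    · exact congrArg Subtype.val (huniq ⟨e, hs.mem_of_adj hy hys he hye⟩ he)
    · obtain ⟨⟨y, hy⟩, hys, hxy, ha⟩ := hn ⟨x, hx⟩ hxs
      exact ⟨y, hy, hys, fun h' => hxy (Subtype.ext h'), ha⟩

theorem IsSum.isRoot (hs : h.IsSum k) (hb : ∀ i, IsBlock H (k i).toHoffmanGraph)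
    (φ : G ↪g h.graph) (hφ : ∀ x, ¬ h.IsFat (φ x)) :
    IsRoot G (fatInc φ) ∧ FitsBlocks H G (fatInc φ) := by
  have hblk : ∀ x : h.V, ∃ i, x ∈ (k i).verts := fun x =>
    Set.mem_iUnion.1 (hs.verts_eq.symm ▸ Set.mem_univ x)
  -- Vertices of different summands with a common fat neighbour are adjacent, so defect edges stay
  -- inside one summand. Hence each connected piece of the defect graph embeds into that summand.
  have same : ∀ x y i j, (defect G (fatInc φ)).Adj x y → φ x ∈ (k i).verts →
      φ y ∈ (k j).verts → i = j := by
    rintro x y i j ⟨hxy, hna, f, hxf, hyf⟩ hx hy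
    by_contra hij
    exact hna (φ.map_adj_iff.1
      (hs.adj_of_common hij hx hy (hφ x) (hφ y) f.2 hxf hyf))
  refine ⟨⟨⟨fun x => ?_, fun x f g e hf hg he => ?_, fun x y f g hxy hxf hyf hxg hyg => ?_⟩,
    fun x y hxy => ?_, fun x y f g hd hf hg => ?_⟩, fun T hT hr => ?_⟩
  · obtain ⟨i, hi⟩ := hblk (φ x)
    rcases hs.two_or_one hb hi (hφ x) with ⟨f, -, -, hf, -, hxf, -⟩ | ⟨f, hf, hall, -⟩
    · exact ⟨⟨f, hf⟩, hxf⟩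
    · exact ⟨⟨f, hf⟩, (hall _ hi (hφ x)).1⟩
  · obtain ⟨i, hi⟩ := hblk (φ x)
    simp only [Subtype.ext_iff]
    rcases hs.two_or_one hb hi (hφ x) with ⟨a, b, -, -, -, -, -, hall, -⟩ | ⟨a, -, hall, -⟩
    · have h1 := hall f f.2 hf
      have h2 := hall g g.2 hg
      have h3 := hall e e.2 he
      grind
    · left
      rw [(hall _ hi (hφ x)).2 f f.2 hf, (hall _ hi (hφ x)).2 g g.2 hg]
  · obtain ⟨i, hi⟩ := hblk (φ x)
    obtain ⟨j, hj⟩ := hblk (φ y)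
    apply Subtype.ext
    by_cases hij : i = j
    · subst hij
      rcases hs.two_or_one hb hi (hφ x) with ⟨-, -, -, -, -, -, -, -, hall⟩ | ⟨a, -, hall, -⟩
      · exact absurd (φ.injective (hall _ hj (hφ y))).symm hxy
      · rw [(hall _ hi (hφ x)).2 f f.2 hxf, (hall _ hi (hφ x)).2 g g.2 hxg]
    · exact hs.eq_of_common hij hi hj (hφ x) (hφ y) f.2 g.2 hxf hyf hxg hyg
  · obtain ⟨i, hi⟩ := hblk (φ x)
    obtain ⟨j, hj⟩ := hblk (φ y)
    by_cases hij : i = j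
    · subst hij
      rcases hs.two_or_one hb hi (hφ x) with ⟨-, -, -, -, -, -, -, -, hall⟩ | ⟨a, ha, hall, -⟩
      · exact absurd (φ.injective (hall _ hj (hφ y))).symm hxy.ne
      · exact ⟨⟨a, ha⟩, (hall _ hi (hφ x)).1, (hall _ hj (hφ y)).1⟩
    · have h1 := (hs.common_eq_one_iff i j hij _ hi _ hj (hφ x) (hφ y)).2 (φ.map_adj_iff.2 hxy)
      obtain ⟨f, hf⟩ := Set.ncard_eq_one.1 h1
      have hf : f ∈ h.fatNbrs (φ x) ∩ h.fatNbrs (φ y) := hf ▸ rfl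
      exact ⟨⟨f, hf.1.1⟩, hf.1.2, hf.2.2⟩
  · obtain ⟨i, hi⟩ := hblk (φ x)
    obtain ⟨j, hj⟩ := hblk (φ y)
    obtain rfl := same x y i j hd hi hj
    apply Subtype.ext
    rcases hs.two_or_one hb hi (hφ x) with ⟨-, -, -, -, -, -, -, -, hall⟩ | ⟨a, -, hall, -⟩
    · exact absurd (φ.injective (hall _ hj (hφ y))).symm hd.1
    · rw [(hall _ hi (hφ x)).2 f f.2 hf, (hall _ hi (hφ x)).2 g g.2 hg]
  · obtain ⟨x, hx, y, hy, hxy⟩ := hT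
    obtain ⟨i, hi⟩ := hblk (φ x)
    have hall : ∀ z ∈ T, φ z ∈ (k i).verts := by
      intro z hz
      obtain ⟨p⟩ := hr x hx z hz
      have : ∀ {s t : V} (_ : (defect G (fatInc φ)).Walk s t), φ s ∈ (k i).verts →
          φ t ∈ (k i).verts := by
        intro s t p
        induction p with
        | nil => exact id
        | @cons s t _ hst _ ih =>
          intro hs'
          obtain ⟨j, hj⟩ := hblk (φ t)
          exact ih (same _ _ _ _ hst hs' hj ▸ hj)
      exact this p hi
    rcases hs.two_or_one hb hi (hφ x) with ⟨-, -, -, -, -, -, -, -, h1⟩ |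
      ⟨-, -, -, ⟨g, hg, hgp, ⟨e⟩⟩, -⟩
    · exact absurd (φ.injective (h1 _ (hall y hy) (hφ y))).symm hxy
    · let ψ : G.induce T ↪g (k i).toHoffmanGraph.graph :=
        { toFun := fun z => ⟨φ z, hall z z.2⟩
          inj' := fun a b hab => Subtype.ext (φ.injective (congrArg Subtype.val hab))
          map_rel_iff' := φ.map_adj_iff }
      exact ⟨g, hg, hgp, e.toEmbedding.comp ψ, fun z hz => hφ z ((e.isFat_iff (ψ z)).1 hz)⟩

/-- A vertex with only one fat neighbour is not in a copy of 𝔥₂, so its summand contains a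
non-neighbour of it, and strictness makes this a vertex of G. -/
theorem IsSum.isStrictRoot (hs : h.IsSum k) (hb : ∀ i, IsBlock H (k i).toHoffmanGraph)
    (φ : G ↪g h.graph) (hφ : ∀ x, ¬ h.IsFat (φ x)) (hsurj : ∀ y, ¬ h.IsFat y → ∃ x, φ x = y) :
    IsStrictRoot G (fatInc φ) := by
  refine ⟨(hs.isRoot hb φ hφ).1, fun f => ?_, fun x f hf => ?_⟩
  · obtain ⟨y, hy, hfy⟩ := h.exists_slim_adj f f.2
    obtain ⟨x, rfl⟩ := hsurj y hy
    exact ⟨x, hfy.symm⟩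
  · obtain ⟨i, hi⟩ := Set.mem_iUnion.1 (hs.verts_eq.symm ▸ Set.mem_univ (φ x))
    rcases hs.two_or_one hb hi (hφ x) with ⟨a, b, hab, ha, hb, hxa, hxb, -⟩ |
      ⟨a, ha, hall, -, y, hy, hys, hxy, hna⟩
    · have h1 := hf ⟨a, ha⟩ hxa
      have h2 := hf ⟨b, hb⟩ hxb
      exact absurd (congrArg Subtype.val (h1.trans h2.symm)) hab
    · obtain ⟨z, rfl⟩ := hsurj y hys
      exact ⟨z, fun h' => hxy (congrArg φ h'), fun h' => hna (φ.map_adj_iff.2 h'), ⟨a, ha⟩,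
        (hall _ hi (hφ x)).1, (hall _ hy hys).1⟩

end FromCover

/-! ### Making a root relation strict -/

section Restrict

variable {V : Type v} {Φ : Type w} {G : SimpleGraph V} {inc : V → Φ → Prop}
  {H : Set HoffmanGraph.{u}}

theorem FitsBlocks.of_share {Ψ : Type*} {inc' : V → Ψ → Prop} (hf : FitsBlocks H G inc)
    (he : ∀ x y, x ≠ y → (Share inc x y ↔ Share inc' x y)) : FitsBlocks H G inc' := by
  intro T hT hr
  rw [← defect_eq_of_share he] at hr
  exact hf T hT hr

/-- The points that need an additional block. -/
def Lonely (G : SimpleGraph V) (inc : V → Φ → Prop) (x : V) : Prop :=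
  (∀ f g, inc x f → inc x g → f = g) ∧ ∀ y, ¬ (defect G inc).Adj x y

/-- Add a private block at every lonely point. -/
def padInc (G : SimpleGraph V) (inc : V → Φ → Prop) (x : V) : Φ ⊕ V → Prop :=
  Sum.elim (inc x) fun y => x = y ∧ Lonely G inc x

/-- Drop the blocks without points. -/
def strictInc (G : SimpleGraph V) (inc : V → Φ → Prop) (x : V)
    (f : {f : Φ ⊕ V // ∃ x, padInc G inc x f}) : Prop := padInc G inc x f

theorem share_strictInc {x y : V} (hxy : x ≠ y) :
    Share inc x y ↔ Share (strictInc G inc) x y := by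
  constructor
  · rintro ⟨f, hx, hy⟩
    exact ⟨⟨Sum.inl f, x, hx⟩, hx, hy⟩
  · rintro ⟨⟨f | z, hf⟩, hx, hy⟩
    · exact ⟨f, hx, hy⟩
    · exact absurd (hx.1.trans hy.1.symm) hxy

/-- Strictness fails in two ways, typically after vertices have been deleted: a block may have no
points, or a point with only one block may have no non-neighbour there. Empty blocks are dropped; a
private second block turns such a point into a copy of 𝔥₂. Neither changes the shared pairs. -/
theorem IsRoot.isStrictRoot (hr : IsRoot G inc) : IsStrictRoot G (strictInc G inc) := by
  have hd : defect G (strictInc G inc) = defect G inc :=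
    (defect_eq_of_share fun x y hxy => share_strictInc hxy).symm
  refine ⟨⟨⟨fun x => ?_, ?_, ?_⟩, fun x y hxy => ?_, ?_⟩, fun f => f.2, fun x f hf => ?_⟩
  · obtain ⟨f, hf⟩ := hr.exists_inc x
    exact ⟨⟨Sum.inl f, x, hf⟩, hf⟩
  · rintro x ⟨f, _⟩ ⟨g, _⟩ ⟨e, _⟩ (hf : padInc G inc x f) (hg : padInc G inc x g)
      (he : padInc G inc x e)
    simp only [Subtype.mk.injEq]
    rcases f with f | f <;> rcases g with g | g <;> rcases e with e | e <;>
      simp only [Sum.inl.injEq, Sum.inr.injEq, reduceCtorEq, false_or, or_false, padInc,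
        Sum.elim_inl, Sum.elim_inr] at *
    · exact hr.eq_of_three x f g e hf hg he
    · exact he.2.1 _ _ hf hg
    · exact hg.2.1 _ _ hf he
    · exact hg.1.symm.trans he.1
    · exact hf.2.1 _ _ hg he
    · exact hf.1.symm.trans he.1
    · exact hf.1.symm.trans hg.1
    · exact Or.inl (hf.1.symm.trans hg.1)
  · rintro x y ⟨f, _⟩ ⟨g, _⟩ hxy (hxf : padInc G inc x f) (hyf : padInc G inc y f)
      (hxg : padInc G inc x g) (hyg : padInc G inc y g)
    simp only [Subtype.mk.injEq]
    rcases f with f | f <;> rcases g with g | g <;>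
      simp only [Sum.inl.injEq, Sum.inr.injEq, reduceCtorEq, padInc, Sum.elim_inl,
        Sum.elim_inr] at *
    · exact hr.eq_of_common x y f g hxy hxf hyf hxg hyg
    · exact hxy (hxg.1.trans hyg.1.symm)
    · exact hxy (hxf.1.trans hyf.1.symm)
    · exact hxf.1.symm.trans hxg.1
  · exact (share_strictInc hxy.ne).1 (hr.share_of_adj x y hxy)
  · rw [hd]
    rintro x y ⟨f, _⟩ ⟨g, _⟩ hxy (hxf : padInc G inc x f) (hxg : padInc G inc x g)
    simp only [Subtype.mk.injEq]
    rcases f with f | f <;> rcases g with g | g <;>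
      simp only [Sum.inl.injEq, Sum.inr.injEq, reduceCtorEq, padInc, Sum.elim_inl,
        Sum.elim_inr] at *
    · exact hr.eq_of_defect x y f g hxy hxf hxg
    · exact hxg.2.2 y hxy
    · exact hxf.2.2 y hxy
    · exact hxf.1.symm.trans hxg.1
  · rw [hd]
    by_contra! hcon
    have hl : Lonely G inc x := by
      refine ⟨fun a b ha hb => ?_, hcon⟩
      have h1 := hf ⟨Sum.inl a, x, ha⟩ ha
      have h2 := hf ⟨Sum.inl b, x, hb⟩ hb
      exact Sum.inl_injective (congrArg Subtype.val (h1.trans h2.symm))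
    obtain ⟨a, ha⟩ := hr.exists_inc x
    have h1 := hf ⟨Sum.inl a, x, ha⟩ ha
    have h2 := hf ⟨Sum.inr x, x, rfl, hl⟩ ⟨rfl, hl⟩
    exact Sum.inl_ne_inr (congrArg Subtype.val (h1.trans h2.symm))

end Restrict

end HoffmanGraph

namespace HoffmanGraph

/-! ### From strict root relations to sums -/

section ToCover

variable {V : Type u} {Φ : Type u} {G : SimpleGraph V} {inc : V → Φ → Prop}

/-- A vertex with a defect lies in a single block, which it shares with its defect neighbours; this
block is passed along a walk. -/
theorem IsRoot.eq_of_reachable (hr : IsRoot G inc) {x y : V} {f : Φ}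
    (hd : (defect G inc).Adj x y) (hxf : inc x f) {z : V} (hz : (defect G inc).Reachable x z) :
    ∀ g, inc z g ↔ g = f := by
  obtain ⟨p⟩ := hz
  have : ∀ {s t : V} (_ : (defect G inc).Walk s t), (∀ g, inc s g ↔ g = f) →
      ∀ g, inc t g ↔ g = f := by
    intro s t p
    induction p with
    | nil => exact id
    | @cons s t _ hst _ ih =>
      intro hs
      obtain ⟨k, hsk, htk⟩ := hst.2.2
      obtain rfl := (hs k).1 hsk
      exact ih fun g => ⟨fun hg => hr.eq_of_defect t s g k hst.symm hg htk, by rintro rfl; exact htk⟩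
  exact this p fun g => ⟨fun hg => hr.eq_of_defect x y g f hd hg hxf, by rintro rfl; exact hxf⟩

/-- Adjacency in the graph obtained from `G` by adding the blocks as vertices. -/
def rootAdj (G : SimpleGraph V) (inc : V → Φ → Prop) : V ⊕ Φ → V ⊕ Φ → Prop
  | Sum.inl x, Sum.inl y => G.Adj x y
  | Sum.inl x, Sum.inr f => inc x f
  | Sum.inr f, Sum.inl x => inc x f
  | Sum.inr _, Sum.inr _ => False

/-- The Hoffman graph with slim part `G` and the blocks as fat vertices. -/
def rootGraph [Finite V] [Finite Φ] (G : SimpleGraph V) (inc : V → Φ → Prop)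
    (hit : ∀ f, ∃ x, inc x f) : HoffmanGraph.{u} where
  V := V ⊕ Φ
  finite := inferInstance
  graph :=
    { Adj := rootAdj G inc
      symm := ⟨by rintro (x | f) (y | g) h; exacts [G.adj_symm h, h, h, h]⟩
      loopless := ⟨by rintro (x | f) h; exacts [G.loopless.irrefl x h, h]⟩ }
  IsFat := Sum.elim (fun _ => False) (fun _ => True)
  exists_slim_adj := by
    rintro (x | f) h
    · exact h.elim
    · obtain ⟨x, hx⟩ := hit f
      exact ⟨Sum.inl x, id, hx⟩
  fat_not_adj := by
    rintro (x | f) (y | g) hx hy h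
    exacts [hx, hx, hy, h]

variable [Finite V] [Finite Φ] {hit : ∀ f, ∃ x, inc x f}

/-- The summand of `rootGraph` belonging to a component of the defect graph. -/
def rootBlock (hit : ∀ f, ∃ x, inc x f) (C : (defect G inc).ConnectedComponent) :
    (rootGraph G inc hit).Subgraph where
  verts := {z | Sum.elim (fun x => x ∈ C.supp) (fun f => ∃ x ∈ C.supp, inc x f) z}
  exists_slim_adj := by
    rintro (x | f) hz hf
    · exact hf.elim
    · obtain ⟨x, hx, hxf⟩ := hz
      exact ⟨Sum.inl x, hx, id, hxf⟩

/-- Vertices in different components are not joined by a defect, so they share a block exactly when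
they are adjacent. -/
theorem IsRoot.isSum (hr : IsRoot G inc) (hit : ∀ f, ∃ x, inc x f) {ι : Type w}
    (e : ι ≃ (defect G inc).ConnectedComponent) :
    (rootGraph G inc hit).IsSum fun i => rootBlock hit (e i) := by
  have ne : ∀ {i j x y}, i ≠ j → x ∈ (e i).supp → y ∈ (e j).supp →
      x ≠ y ∧ ¬ (defect G inc).Adj x y := by
    intro i j x y hij hx hy
    rw [SimpleGraph.ConnectedComponent.mem_supp_iff] at hx hy
    have hne : (defect G inc).connectedComponentMk x ≠ (defect G inc).connectedComponentMk y := by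
      rw [hx, hy]; exact fun h => hij (e.injective h)
    exact ⟨fun h => hne (h ▸ rfl),
      fun h => hne (SimpleGraph.ConnectedComponent.sound h.reachable)⟩
  have le : ∀ i j, i ≠ j → ∀ x ∈ (e i).supp, ∀ y ∈ (e j).supp,
      ((rootGraph G inc hit).fatNbrs (Sum.inl x) ∩
        (rootGraph G inc hit).fatNbrs (Sum.inl y)).ncard ≤ 1 := by
    intro i j hij x hx y hy
    rw [Set.ncard_le_one (Set.toFinite _)]
    rintro (z | f) ⟨hf, hf'⟩ (z | g) ⟨hg, hg'⟩
    · exact hf.1.elim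
    · exact hf.1.elim
    · exact hg.1.elim
    · rw [hr.eq_of_common x y f g (ne hij hx hy).1 hf.2 hf'.2 hg.2 hg'.2]
  refine ⟨Set.eq_univ_of_forall ?_, fun i j hij => ?_, ?_, ?_, ?_⟩
  · rintro (x | f)
    · exact Set.mem_iUnion.2 ⟨e.symm ((defect G inc).connectedComponentMk x),
        show x ∈ (e (e.symm _)).supp by rw [e.apply_symm_apply]; rfl⟩
    · obtain ⟨x, hx⟩ := hit f
      exact Set.mem_iUnion.2 ⟨e.symm ((defect G inc).connectedComponentMk x),
        x, by rw [e.apply_symm_apply]; rfl, hx⟩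
  · rw [Set.disjoint_left]
    rintro (x | f) ⟨hx, hs⟩ ⟨hx', -⟩
    · exact (ne hij hx hx').1 rfl
    · exact hs trivial
  · rintro i (x | f) hx hs
    · rw [Set.inter_eq_left]
      rintro (z | f) hf
      · exact hf.1.elim
      · exact ⟨x, hx, hf.2⟩
    · exact (hs trivial).elim
  · rintro i j hij (x | f) hx (y | g) hy hxs hys
    · exact le i j hij x hx y hy
    · exact (hys trivial).elim
    · exact (hxs trivial).elim
    · exact (hxs trivial).elim
  · rintro i j hij (x | f) hx (y | g) hy hxs hys
    · obtain ⟨hxy, hd⟩ := ne hij hx hy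
      constructor
      · intro h
        by_contra hna
        obtain ⟨z, hz⟩ := Set.ncard_eq_one.1 h
        have hz : z ∈ (rootGraph G inc hit).fatNbrs (Sum.inl x) ∩
          (rootGraph G inc hit).fatNbrs (Sum.inl y) := hz ▸ rfl
        rcases z with z | f
        · exact hz.1.1
        · exact hd ⟨hxy, hna, f, hz.1.2, hz.2.2⟩
      · intro h
        obtain ⟨f, hxf, hyf⟩ := hr.share_of_adj x y h
        exact le_antisymm (le i j hij x hx y hy) ((Set.ncard_pos (Set.toFinite _)).2
          ⟨Sum.inr f, ⟨trivial, hxf⟩, trivial, hyf⟩)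
    · exact (hys trivial).elim
    · exact (hxs trivial).elim
    · exact (hxs trivial).elim

/-- A component with an edge has one block and is indecomposable because its defect graph is
connected; the embedding of its slim part given by `FitsBlocks` extends by matching the fat
vertices. An isolated vertex has a second block by `exists_defect`, so it gives 𝔥₂. -/
theorem IsStrictRoot.rootBlock_mem {H : Set HoffmanGraph.{u}} (hr : IsStrictRoot G inc)
    (hf : FitsBlocks H G inc) (C : (defect G inc).ConnectedComponent) :
    (rootBlock hr.exists_point C).toHoffmanGraph ∈ familyBar H := by
  classical
  obtain ⟨x, hx⟩ := C.nonempty_supp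
  obtain ⟨f, hxf⟩ := hr.exists_inc x
  have hreach : ∀ y ∈ C.supp, ∀ z ∈ C.supp, (defect G inc).Reachable y z := fun y hy z hz =>
    C.reachable_of_mem_supp hy hz
  by_cases hd : ∃ y, (defect G inc).Adj x y
  · obtain ⟨y, hxy⟩ := hd
    have hy : y ∈ C.supp := C.mem_supp_of_adj_mem_supp hx hxy
    have hinc : ∀ z ∈ C.supp, ∀ g, inc z g ↔ g = f := fun z hz =>
      hr.eq_of_reachable hxy hxf (hreach x hx z hz)
    let k := (rootBlock hr.exists_point C).toHoffmanGraph
    let f₀ : k.V := ⟨Sum.inr f, x, hx, hxf⟩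
    have huniq : ∀ g, k.IsFat g → g = f₀ := by
      rintro ⟨z | g, hg⟩ hfat
      · exact hfat.elim
      · obtain ⟨z, hz, hzg⟩ := hg
        exact Subtype.ext (congrArg Sum.inr ((hinc z hz g).1 hzg))
    have hadj : ∀ z, ¬ k.IsFat z → k.graph.Adj z f₀ := by
      rintro ⟨z | g, hg⟩ hs
      · exact (hinc z hg f).2 rfl
      · exact (hs trivial).elim
    have hp : k.IsPointed := ⟨f₀, trivial, huniq, hadj⟩
    let D : SimpleGraph k.V :=
      { Adj := fun a b => ¬ k.IsFat a ∧ ¬ k.IsFat b ∧ a ≠ b ∧ ¬ k.graph.Adj a b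
        symm := ⟨fun a b h => ⟨h.2.1, h.1, h.2.2.1.symm, fun h' => h.2.2.2 h'.symm⟩⟩
        loopless := ⟨fun a h => h.2.2.1 rfl⟩ }
    let ψ : C.toSimpleGraph →g D :=
      { toFun := fun a => ⟨Sum.inl a.1, a.2⟩
        map_rel' := fun {a b} h =>
          ⟨id, id, fun h' => h.1 (Sum.inl_injective (congrArg Subtype.val h')), h.2.1⟩ }
    refine Or.inr ⟨Or.inr ⟨indecomposable_of_reachable (D := D) hp
      (fun a b h => ⟨h.1, h.2.1, h.2.2.2⟩) ?_, fun z hz => ⟨f₀, trivial, hadj z hz⟩, ?_, ?_⟩, ?_⟩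
    · rintro ⟨a | g, ha⟩ ⟨b | g, hb⟩ has hbs
      · exact (C.connected_toSimpleGraph.preconnected ⟨a, ha⟩ ⟨b, hb⟩).map ψ
      · exact (hbs trivial).elim
      · exact (has trivial).elim
      · exact (has trivial).elim
    · refine (Set.one_lt_ncard (Set.toFinite _)).2
        ⟨(⟨Sum.inl x, hx⟩ : k.V), id, (⟨Sum.inl y, hy⟩ : k.V), id, fun h' => ?_⟩
      exact hxy.1 (Sum.inl_injective (congrArg Subtype.val h'))
    · refine Set.ncard_eq_one.2 ⟨f₀, Set.ext fun g => ⟨fun hg => huniq g hg, ?_⟩⟩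
      rintro rfl
      exact trivial
    · obtain ⟨g, hg, ⟨f', hf', huniq', hadj'⟩, φ, hφ⟩ := hf C.supp ⟨x, hx, y, hy, hxy.1⟩ hreach
      have hne : ∀ a, φ a ≠ f' := fun a h => hφ a (h ▸ hf')
      let χ : k.V → g.V := fun z => match z with
        | ⟨Sum.inl z, hz⟩ => φ ⟨z, hz⟩
        | ⟨Sum.inr _, _⟩ => f'
      let i : Embedding k g :=
        { toEmbedding :=
            { toFun := χ
              inj' := by
                rintro ⟨a | a, ha⟩ ⟨b | b, hb⟩ hab
                · have := φ.injective hab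
                  exact Subtype.ext (congrArg Sum.inl (congrArg Subtype.val this))
                · exact (hne _ hab).elim
                · exact (hne _ hab.symm).elim
                · exact (huniq ⟨Sum.inr a, ha⟩ trivial).trans (huniq ⟨Sum.inr b, hb⟩ trivial).symm
              map_rel_iff' := by
                rintro ⟨a | a, ha⟩ ⟨b | b, hb⟩
                · exact φ.map_adj_iff
                · exact ⟨fun _ => by rw [huniq ⟨Sum.inr b, hb⟩ trivial]; exact hadj _ id,
                    fun _ => hadj' _ (hφ _)⟩
                · exact ⟨fun _ => by rw [huniq ⟨Sum.inr a, ha⟩ trivial]; exact (hadj _ id).symm,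
                    fun _ => (hadj' _ (hφ _)).symm⟩
                · exact ⟨fun h => (g.fat_not_adj _ _ hf' hf' h).elim, fun h => h.elim⟩ }
          isFat_iff := by
            rintro ⟨a | a, ha⟩
            · exact ⟨fun h => (hφ _ h).elim, fun h => h.elim⟩
            · exact ⟨fun _ => trivial, fun _ => hf'⟩ }
      exact ⟨g, hg, i.range, i.nonempty_iso_range⟩
  · left
    push Not at hd
    obtain ⟨g, hxg, hgf⟩ : ∃ g, inc x g ∧ g ≠ f := by
      by_contra! hcon
      obtain ⟨y, hy⟩ := hr.exists_defect x f hcon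
      exact hd y hy
    have hsing : ∀ z ∈ C.supp, z = x := by
      intro z hz
      obtain ⟨p⟩ := hreach x hx z hz
      cases p with
      | nil => rfl
      | cons h _ => exact absurd h (hd _)
    refine IsDouble.nonempty_iso ⟨⟨Sum.inl x, hx⟩, ⟨Sum.inr f, x, hx, hxf⟩,
      ⟨Sum.inr g, x, hx, hxg⟩, fun h => ?_, id, trivial, trivial, hxf, hxg, ?_⟩ isDouble_h2
    · exact hgf (Sum.inr_injective (congrArg Subtype.val h)).symm
    · rintro ⟨z | e, he⟩
      · exact Or.inl (Subtype.ext (congrArg Sum.inl (hsing z he)))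
      · obtain ⟨z, hz, hze⟩ := he
        obtain rfl := hsing z hz
        rcases hr.eq_of_three z f g e hxf hxg hze with h | rfl | rfl
        · exact absurd h.symm hgf
        · exact Or.inr (Or.inl rfl)
        · exact Or.inr (Or.inr rfl)

end ToCover

/-! ### Covers of slim graphs as root relations -/

section Covers

/-- The strict cover of a slim graph given by a strict root relation. -/
def rootCover {H : Set HoffmanGraph.{u}} {g : HoffmanGraph.{u}} [Nonempty g.V] (hg : g.IsSlim)
    {Φ : Type u} [Finite Φ] {inc : g.V → Φ → Prop} (hr : IsStrictRoot g.graph inc)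
    (hf : FitsBlocks H g.graph inc) : Cover (familyBar H) g where
  h := rootGraph g.graph inc hr.exists_point
  emb := ⟨⟨⟨Sum.inl, Sum.inl_injective⟩, Iff.rfl⟩, fun x => ⟨fun h => h.elim, fun h => hg x h⟩⟩
  exists_sum := by
    obtain ⟨n, ⟨e⟩⟩ := Finite.exists_equiv_fin (defect g.graph inc).ConnectedComponent
    obtain _ | n := n
    -- A sum in `Cover` has n + 1 summands, so there must be a component; this uses that g is
    -- non-empty.
    · exact (e ((defect g.graph inc).connectedComponentMk (Classical.arbitrary g.V))).elim0
    · exact ⟨n, _, hr.isSum hr.exists_point e.symm,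
        fun i => ⟨_, hr.rootBlock_mem hf (e.symm i), ⟨Iso.refl _⟩⟩⟩

variable {H F : Set HoffmanGraph.{u}} {g : HoffmanGraph.{u}}

theorem rootCover_isStrict [Nonempty g.V] (hg : g.IsSlim) {Φ : Type u} [Finite Φ]
    {inc : g.V → Φ → Prop} (hr : IsStrictRoot g.graph inc) (hf : FitsBlocks H g.graph inc) :
    (rootCover hg hr hf).IsStrict := by
  ext z
  constructor
  · rintro ⟨x, -, rfl⟩
    exact id
  · rcases z with x | f
    · exact fun _ => ⟨x, hg x, rfl⟩
    · exact fun h => (h trivial).elim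

/-- The incidence relation of a cover. -/
def Cover.inc (c : Cover F g) : g.V → {f // c.h.IsFat f} → Prop := fatInc c.emb.toEmbedding

theorem share_rootCover [Nonempty g.V] (hg : g.IsSlim) {Φ : Type u} [Finite Φ]
    {inc : g.V → Φ → Prop} (hr : IsStrictRoot g.graph inc) (hf : FitsBlocks H g.graph inc)
    (x y : g.V) : Share (rootCover hg hr hf).inc x y ↔ Share inc x y := by
  constructor
  · rintro ⟨⟨z | f, hz⟩, hx, hy⟩
    · exact hz.elim
    · exact ⟨f, hx, hy⟩
  · rintro ⟨f, hx, hy⟩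
    exact ⟨⟨Sum.inr f, trivial⟩, hx, hy⟩

theorem Cover.Equivalent.share {c c' : Cover F g} (h : c.Equivalent c') {x y : g.V}
    (hs : Share c.inc x y) : Share c'.inc x y := by
  obtain ⟨φ, hφ⟩ := h
  obtain ⟨f, hx, hy⟩ := hs
  have key : ∀ x, c.inc x f → c'.h.graph.Adj (c'.emb.toEmbedding x) (φ.toIso f) := fun x hx => by
    rw [← hφ, φ.toIso.map_adj_iff]; exact hx
  exact ⟨⟨φ.toIso f, (φ.isFat_iff f).2 f.2⟩, key x hx, key y hy⟩

theorem Cover.not_isFat (hg : g.IsSlim) (c : Cover F g) (x : g.V) :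
    ¬ c.h.IsFat (c.emb.toEmbedding x) := fun h => hg x ((c.emb.isFat_iff x).1 h)

theorem Cover.exists_isBlock_sum (hF : ∀ k ∈ F, IsBlock H k) (c : Cover F g) :
    ∃ (n : ℕ) (k : Fin (n + 1) → c.h.Subgraph),
      c.h.IsSum k ∧ ∀ i, IsBlock H (k i).toHoffmanGraph := by
  obtain ⟨n, k, hs, hk⟩ := c.exists_sum
  refine ⟨n, k, hs, fun i => ?_⟩
  obtain ⟨j, hj, ⟨e⟩⟩ := hk i
  exact (hF j hj).of_iso e

theorem Cover.isRoot (hF : ∀ k ∈ F, IsBlock H k) (hg : g.IsSlim) (c : Cover F g) :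
    IsRoot g.graph c.inc ∧ FitsBlocks H g.graph c.inc := by
  obtain ⟨n, k, hs, hb⟩ := c.exists_isBlock_sum hF
  exact hs.isRoot hb c.emb.toEmbedding (c.not_isFat hg)

theorem Cover.IsStrict.exists_eq {c : Cover F g} (hc : c.IsStrict) (y : c.h.V)
    (hy : ¬ c.h.IsFat y) : ∃ x, c.emb.toEmbedding x = y := by
  have hy : y ∈ c.h.slimVerts := hy
  rw [← hc] at hy
  obtain ⟨x, -, hx⟩ := hy
  exact ⟨x, hx⟩

theorem Cover.IsStrict.isStrictRoot (hF : ∀ k ∈ F, IsBlock H k) (hg : g.IsSlim) {c : Cover F g}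
    (hc : c.IsStrict) : IsStrictRoot g.graph c.inc := by
  obtain ⟨n, k, hs, hb⟩ := c.exists_isBlock_sum hF
  exact hs.isStrictRoot hb c.emb.toEmbedding (c.not_isFat hg) hc.exists_eq

/-- The vertices of a strict cover of a slim graph. -/
noncomputable def Cover.IsStrict.vertEquiv (hg : g.IsSlim) {c : Cover F g} (hc : c.IsStrict) :
    g.V ⊕ {f // c.h.IsFat f} ≃ c.h.V :=
  Equiv.ofBijective (Sum.elim c.emb.toEmbedding Subtype.val) <| by
    constructor
    · rintro (x | f) (y | f') h
      · exact congrArg Sum.inl (c.emb.toEmbedding.injective h)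
      · exact absurd (show c.h.IsFat (c.emb.toEmbedding x) from
          (show c.emb.toEmbedding x = f' from h) ▸ f'.2) (c.not_isFat hg x)
      · exact absurd (show c.h.IsFat (c.emb.toEmbedding y) from
          (show f = c.emb.toEmbedding y from h) ▸ f.2) (c.not_isFat hg y)
      · exact congrArg Sum.inr (Subtype.ext h)
    · intro z
      by_cases hz : c.h.IsFat z
      · exact ⟨Sum.inr ⟨z, hz⟩, rfl⟩
      · obtain ⟨x, hx⟩ := hc.exists_eq z hz
        exact ⟨Sum.inl x, hx⟩

theorem Cover.equivalent_of_equiv (hg : g.IsSlim) {c c' : Cover F g} (hc : c.IsStrict)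
    (hc' : c'.IsStrict) (σ : {f // c.h.IsFat f} ≃ {f // c'.h.IsFat f})
    (hσ : ∀ x f, c.inc x f ↔ c'.inc x (σ f)) : c.Equivalent c' := by
  let e := ((hc.vertEquiv hg).symm.trans ((Equiv.refl g.V).sumCongr σ)).trans (hc'.vertEquiv hg)
  have he : ∀ z, e (hc.vertEquiv hg z) = hc'.vertEquiv hg (Sum.map id σ z) := fun z => by
    simp only [e, Equiv.trans_apply, Equiv.symm_apply_apply, Equiv.sumCongr_apply]
    rfl
  refine ⟨⟨⟨e, ?_⟩, ?_⟩, fun x => he (Sum.inl x)⟩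
  · intro a b
    obtain ⟨a, rfl⟩ := (hc.vertEquiv hg).surjective a
    obtain ⟨b, rfl⟩ := (hc.vertEquiv hg).surjective b
    rw [he, he]
    rcases a with x | f <;> rcases b with y | f'
    · exact c'.emb.toEmbedding.map_adj_iff.trans c.emb.toEmbedding.map_adj_iff.symm
    · exact (hσ x f').symm
    · rw [SimpleGraph.adj_comm, c.h.graph.adj_comm]
      exact (hσ y f).symm
    · exact ⟨fun h => (c'.h.fat_not_adj _ _ (σ f).2 (σ f').2 h).elim,
        fun h => (c.h.fat_not_adj _ _ f.2 f'.2 h).elim⟩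
  · intro a
    obtain ⟨a, rfl⟩ := (hc.vertEquiv hg).surjective a
    change c'.h.IsFat (e _) ↔ _
    rw [he]
    rcases a with x | f
    · exact iff_of_false (c'.not_isFat hg x) (c.not_isFat hg x)
    · exact iff_of_true (σ f).2 f.2

end Covers

end HoffmanGraph

/-! ### The induction step -/

namespace HoffmanGraph

variable {H F : Set HoffmanGraph.{u}} {g : HoffmanGraph.{u}}

/-- Passing through root relations discards superfluous slim vertices and moves the summands from F
into `familyBar H`, while the shared pairs survive. -/
theorem Cover.exists_isStrict (hF : ∀ k ∈ F, IsBlock H k) [Nonempty g.V] (hg : g.IsSlim)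
    (c : Cover F g) : ∃ d : Cover (familyBar H) g, d.IsStrict ∧
      ∀ x y, x ≠ y → (Share c.inc x y ↔ Share d.inc x y) := by
  obtain ⟨hr, hf⟩ := c.isRoot hF hg
  have hf' := hf.of_share fun x y hxy => share_strictInc (G := g.graph) (inc := c.inc) hxy
  exact ⟨rootCover hg hr.isStrictRoot hf', rootCover_isStrict hg hr.isStrictRoot hf',
    fun x y hxy => (share_strictInc hxy).trans (share_rootCover hg hr.isStrictRoot hf' x y).symm⟩

/-- A cover of `g` as a cover of a Hoffman subgraph of `g`. -/
def Cover.restrict (c : Cover F g) (k : g.Subgraph) : Cover F k.toHoffmanGraph :=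
  ⟨c.h, k.incl.trans c.emb, c.exists_sum⟩

/-- If connected slim line graphs of order `n` have unique strict covers, then two strict covers
of a connected slim line graph of order `n + 1` agree on close pairs. -/
theorem Cover.share_of_dist_lt (hH : H ⊆ familyO) {n : ℕ}
    (huniq : ∀ G : HoffmanGraph.{u}, IsConnectedSlimLine H G → Nat.card G.V = n →
      HasUniqueStrictCover (familyBar H) G)
    (hg : IsConnectedSlimLine H g) (hn : Nat.card g.V = n + 1) (c c' : Cover (familyBar H) g)
    {x y : g.V} (hxy : x ≠ y) (hd : g.graph.dist x y < n) (hs : Share c.inc x y) :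
    Share c'.inc x y := by
  obtain ⟨hslim, ⟨c₀⟩, hconn⟩ := hg
  obtain ⟨A, hx, hy, hA, hAc⟩ := exists_connected_induce hconn hn hd
  let k : g.Subgraph := ⟨A, fun x _ hx => absurd hx (hslim x)⟩
  have hks : k.toHoffmanGraph.IsSlim := fun x => hslim x.1
  have : Nonempty k.toHoffmanGraph.V := ⟨⟨x, hx⟩⟩
  have hF := fun j hj => isBlock_of_mem_familyBar hH (k := j) hj
  -- The restricted covers still contain the deleted vertex as a slim vertex if c and c' were
  -- strict, so they are replaced by strict ones with the same shared pairs before uniqueness is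
  -- applied.
  obtain ⟨d, hd, hcd⟩ := (c.restrict k).exists_isStrict hF hks
  obtain ⟨d', hd', hcd'⟩ := (c'.restrict k).exists_isStrict hF hks
  have he := (huniq k.toHoffmanGraph ⟨hks, ⟨c₀.restrict k⟩, hAc⟩ hA).2 d d' hd hd'
  have hne : (⟨x, hx⟩ : k.toHoffmanGraph.V) ≠ ⟨y, hy⟩ := fun h => hxy (congrArg Subtype.val h)
  exact (hcd' _ _ hne).2 (he.share ((hcd _ _ hne).1 hs))

theorem exists_adj_dist {V : Type u} {G : SimpleGraph V} (hG : G.Connected) {x y : V}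
    (hxy : x ≠ y) : ∃ z, G.Adj x z ∧ G.dist x y = G.dist z y + 1 := by
  obtain ⟨p, hp⟩ := hG.exists_walk_length_eq_dist x y
  cases p with
  | nil => exact absurd rfl hxy
  | @cons _ z _ h q =>
    refine ⟨z, h, le_antisymm ?_ ?_⟩
    · have := hG.dist_triangle (u := x) (v := z) (w := y)
      rw [SimpleGraph.dist_eq_one_iff_adj.2 h] at this
      omega
    · rw [← hp, SimpleGraph.Walk.length_cons]
      exact Nat.succ_le_succ (SimpleGraph.dist_le q)

/-- Only distance n remains. Let z and t be the next two vertices after x on a shortest path to y.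
The block f shared by x and y is the only block of x, hence contains z; then it is the only block of
z, hence contains t. The closer pairs x, t and t, y transfer to c', where t has only one block
because it is not adjacent to y. So x and y share that block. -/
theorem Cover.share_of_isStrict (hH : H ⊆ familyO) {n : ℕ} (h7 : 7 ≤ n)
    (huniq : ∀ G : HoffmanGraph.{u}, IsConnectedSlimLine H G → Nat.card G.V = n →
      HasUniqueStrictCover (familyBar H) G)
    (hg : IsConnectedSlimLine H g) (hn : Nat.card g.V = n + 1) {c c' : Cover (familyBar H) g}
    (hc : c.IsStrict) (hc' : c'.IsStrict) {x y : g.V} (hxy : x ≠ y) (hs : Share c.inc x y) :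
    Share c'.inc x y := by
  have near := @Cover.share_of_dist_lt H g hH n huniq hg hn c c'
  by_cases hd : g.graph.dist x y < n
  · exact near hxy hd hs
  have hF := fun j hj => isBlock_of_mem_familyBar hH (k := j) hj
  have hr := hc.isStrictRoot hF hg.1
  have hr' := hc'.isStrictRoot hF hg.1
  have hle : g.graph.dist x y ≤ n := by
    have := hg.2.2.exists_path_of_dist x y
    obtain ⟨p, hp, hlen⟩ := this
    classical
    have := Fintype.ofFinite g.V
    have := hp.length_lt
    rw [← Nat.card_eq_fintype_card] at this
    omega
  have nadj : ∀ {a b : g.V}, g.graph.dist a b ≠ 1 → ¬ g.graph.Adj a b := fun h h' =>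
    h (SimpleGraph.dist_eq_one_iff_adj.2 h')
  have dne : ∀ {a b : g.V}, g.graph.dist a b ≠ 0 → a ≠ b := by
    rintro a _ h rfl
    exact h SimpleGraph.dist_self
  obtain ⟨z, hxz, hz⟩ := exists_adj_dist hg.2.2 hxy
  have hzy : z ≠ y := dne (by omega)
  obtain ⟨t, hzt, ht⟩ := exists_adj_dist hg.2.2 hzy
  have hty : t ≠ y := dne (by omega)
  have htri := hg.2.2.dist_triangle (u := x) (v := t) (w := y)
  have htri' := hg.2.2.dist_triangle (u := x) (v := z) (w := t)
  -- Together the triangle inequalities give `dist x t = 2`, while `dist t y = n - 2`. Since n ≥ 7,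
  -- both pairs are non-adjacent and closer than n.
  rw [SimpleGraph.dist_eq_one_iff_adj.2 hxz, SimpleGraph.dist_eq_one_iff_adj.2 hzt] at htri'
  have hxt : x ≠ t := dne (by omega)
  have hxt' : ¬ g.graph.Adj x t := nadj (by omega)
  have hty' : ¬ g.graph.Adj t y := nadj (by omega)
  obtain ⟨f, hxf, hyf⟩ := hs
  have hdxy : (defect g.graph c.inc).Adj x y := ⟨hxy, nadj (by omega), f, hxf, hyf⟩
  obtain ⟨f₁, hx1, hz1⟩ := hr.share_of_adj x z hxz
  obtain rfl := hr.eq_of_defect x y f f₁ hdxy hxf hx1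
  have hdzy : (defect g.graph c.inc).Adj z y := ⟨hzy, nadj (by omega), f, hz1, hyf⟩
  obtain ⟨f₂, hz2, ht2⟩ := hr.share_of_adj z t hzt
  obtain rfl := hr.eq_of_defect z y f f₂ hdzy hz1 hz2
  obtain ⟨g₁, hxg, htg⟩ := near hxt (by omega) ⟨f, hxf, ht2⟩
  obtain ⟨g₂, htg', hyg⟩ := near hty (by omega) ⟨f, ht2, hyf⟩
  obtain rfl := hr'.eq_of_defect t y g₁ g₂ ⟨hty, hty', g₂, htg', hyg⟩ htg htg'
  exact ⟨g₁, hxg, hyg⟩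

theorem hasUniqueStrictCover_succ (hH : H ⊆ familyO) {n : ℕ} (h7 : 7 ≤ n)
    (huniq : ∀ G : HoffmanGraph.{u}, IsConnectedSlimLine H G → Nat.card G.V = n →
      HasUniqueStrictCover (familyBar H) G)
    (hg : IsConnectedSlimLine H g) (hn : Nat.card g.V = n + 1) :
    HasUniqueStrictCover (familyBar H) g := by
  obtain ⟨c₀⟩ := hg.2.1
  have := hg.2.2.nonempty
  refine ⟨?_, fun c c' hc hc' => ?_⟩
  -- Existence needs no induction hypothesis: the given H-cover is made strict directly.
  · obtain ⟨d, hd, -⟩ := c₀.exists_isStrict (fun j hj => isBlock_of_mem hH hj) hg.1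
    exact ⟨d, hd⟩
  · have hF := fun j hj => isBlock_of_mem_familyBar hH (k := j) hj
    obtain ⟨σ, hσ⟩ := (hc.isStrictRoot hF hg.1).exists_equiv (hc'.isStrictRoot hF hg.1)
      (fun x y hxy => ⟨Cover.share_of_isStrict hH h7 huniq hg hn hc hc' hxy,
        Cover.share_of_isStrict hH h7 huniq hg hn hc' hc hxy⟩) hg.2.2 (by omega)
    exact Cover.equivalent_of_equiv hg.1 hc hc' σ hσ

end HoffmanGraph

theorem theorem1p4 (H : Set HoffmanGraph.{u}) (hH : H ⊆ HoffmanGraph.familyO)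
    (h2H : HoffmanGraph.h2.MemUpToIso H) (N : ℕ) (hN : 7 ≤ N)
    (huniq : ∀ G : HoffmanGraph.{u}, HoffmanGraph.IsConnectedSlimLine H G → Nat.card G.V = N →
      HoffmanGraph.HasUniqueStrictCover (HoffmanGraph.familyBar H) G) :
    ∀ G : HoffmanGraph.{u}, HoffmanGraph.IsConnectedSlimLine H G → N ≤ Nat.card G.V →
      HoffmanGraph.HasUniqueStrictCover (HoffmanGraph.familyBar H) G := by
  have key : ∀ n, N ≤ n → ∀ G : HoffmanGraph.{u}, HoffmanGraph.IsConnectedSlimLine H G →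
      Nat.card G.V = n → HoffmanGraph.HasUniqueStrictCover (HoffmanGraph.familyBar H) G := by
    intro n hn
    induction n, hn using Nat.le_induction with
    | base => exact huniq
    | succ n hn ih =>
      exact fun G hG hGn => HoffmanGraph.hasUniqueStrictCover_succ hH (hN.trans hn) ih hG hGn
  exact fun G hG hGN => key _ hGN G hG rfl
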